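/- **Lemma (Generalized localization).** Let $\mathbb S^2\subset\mathbb R^3$ be the unit sphere with surface measure $\mathrm d\Omega$; identify a point $x\in\mathbb S^2$ with the unit normal at $x$. Let $\nabla_S$ and $\Delta_S$ be the surface gradient and the Laplace–Beltrami operator. For integers $\ell\ge 0$ and $|m|\le \ell$ let $$Y_{\ell,m}=\frac{e^{\mathrm i m\varphi}}{\sqrt{2\pi}}\,\mathrm i^{m+|m|}\sqrt{\left(\ell+\tfrac12\right)\frac{(\ell-m)!}{(\ell+m)!}}\;P_\ell^m(\cos\theta)$$ be the spherical harmonics ($\theta$ the colatitude, $\varphi$ the longitude, $P_\ell^m(t)=\frac{(-1)^m}{2^\ell\ell!}(1-t^2)^{m/2}\frac{\mathrm d^{\ell+m}}{\mathrm dt^{\ell+m}}(t^2-1)^\ell$), and for $g\in L^1(-1,1)$ put $$\lambda_\ell\{g\}=2\pi\int_{-1}^1P_\ell(t)\,g(t)\,\mathrm dt,$$ where $P_\ell=P_\ell^0$ is the Legendre polynomial. Vector fields take values in $\mathbb C^3$, and $\times$ is the (complex bilinear) cross product. Let $f\in L^1(-1,1)$ be real valued with weak derivative $f'\in L^1_{\mathrm{loc}}(-1,1)$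 such that $\sqrt{1-t^2}\,f'\in L^1(-1,1)$. Let $\ell\ge0$, $|m|\le\ell$ and $x\in\mathbb S^2$. (a) If moreover $(1-t)f'\in L^1(-1,1)$, then the following integrals converge absolutely and $$\int_{\mathbb S^2} f'(x\cdot y)(y-x)\,Y_{\ell,m}(y)\,\mathrm d\Omega(y)=\lambda_\ell\{(t-1)f'\}\,Y_{\ell,m}(x)\,x+\lambda_\ell\{f\}\,\nabla_SY_{\ell,m}(x),$$ $$\int_{\mathbb S^2} f'(x\cdot y)(y-x)\times\nabla_SY_{\ell,m}(y)\,\mathrm d\Omega(y)=\lambda_\ell\{(1-t)f'-f\}\;x\times\nabla_SY_{\ell,m}(x),$$ $$\int_{\mathbb S^2} f'(x\cdot y)(y-x)\times\bigl(y\times\nabla_SY_{\ell,m}(y)\bigr)\,\mathrm d\Omega(y)=\lambda_\ell\{f\}\,\Delta_SY_{\ell,m}(x)\,x+\lambda_\ell\{(1-t)f'-f\}\,\nabla_SY_{\ell,m}(x).$$ (b) Without this additional assumption, the following integral converges absolutely and $$\int_{\mathbb S^2} f'(x\cdot y)(y-x)\times\bigl(Y_{\ell,m}(y)\,y\bigr)\,\mathrm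 d\Omega(y)=-\lambda_\ell\{f\}\;x\times\nabla_SY_{\ell,m}(x).$$ -/

import Mathlib

open MeasureTheory Set

open scoped Matrix ContDiff

noncomputable section

namespace SphereCalc

/-- Euclidean three-space. -/
abbrev E3 : Type := EuclideanSpace ℝ (Fin 3)

/-- The unit two-sphere in Euclidean three-space. -/
abbrev S2 : Type := Metric.sphere (0 : E3) 1

/-- The standard surface measure on the sphere (total mass `4π`). -/
def surf : Measure S2 := (volume : Measure E3).toSphere

/-- Euclidean inner product `x · y` of two points of the sphere. -/
def dotS (x y : S2) : ℝ := inner ℝ (x : E3) (y : E3)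

/-- A point of the sphere viewed as a (complex) vector, the unit normal. Spherical harmonics are
complex valued, so vector fields on the sphere take values in `ℂ³ = Fin 3 → ℂ`. -/
def nu (x : S2) : Fin 3 → ℂ := fun i => (((x : E3) i : ℝ) : ℂ)

/-- The extension of a function on the sphere to three-space that is constant along open rays
from the origin (with the irrelevant value `0` at the origin). -/
def radialExt (u : S2 → ℂ) (v : E3) : ℂ :=
  if h : v = 0 then 0
  else u ⟨‖v‖⁻¹ • v, by
    rw [mem_sphere_zero_iff_norm, norm_smul, norm_inv, norm_norm,
      inv_mul_cancel₀ (norm_ne_zero_iff.mpr h)]⟩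

/-- The surface gradient: at a point of the sphere it is the Euclidean gradient of the radially
constant extension. Away from the poles it is `∂_θ u e_θ + csc θ ∂_φ u e_φ`. -/
def surfGrad (u : S2 → ℂ) (x : S2) : Fin 3 → ℂ :=
  fun i => fderiv ℝ (radialExt u) (x : E3) (EuclideanSpace.single i (1 : ℝ))

/-- The Laplace–Beltrami operator: at a point of the sphere it is the Euclidean Laplacian of
the radially constant extension. -/
def surfLaplacian (u : S2 → ℂ) (x : S2) : ℂ :=
  Laplacian.laplacian (radialExt u) (x : E3)

/-- The associated Legendre function of degree `ℓ` and order `m`, `-ℓ ≤ m ≤ ℓ`: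
`P_ℓ^m(t) = (-1)^m / (2^ℓ ℓ!) (1 - t²)^(m/2) (d/dt)^(ℓ+m) (t² - 1)^ℓ`. -/
def assocLegendre (ℓ : ℕ) (m : ℤ) (t : ℝ) : ℝ :=
  (-1 : ℝ) ^ m / (2 ^ ℓ * (ℓ.factorial : ℝ)) * (1 - t ^ 2) ^ ((m : ℝ) / 2) *
    (Polynomial.derivative^[((ℓ : ℤ) + m).toNat]
      (((Polynomial.X : Polynomial ℝ) ^ 2 - 1) ^ ℓ)).eval t

/-- The Legendre polynomial `P_ℓ(t) = 1 / (2^ℓ ℓ!) (d/dt)^ℓ (t² - 1)^ℓ`. -/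
def legendreP (ℓ : ℕ) (t : ℝ) : ℝ :=
  1 / (2 ^ ℓ * (ℓ.factorial : ℝ)) *
    (Polynomial.derivative^[ℓ] (((Polynomial.X : Polynomial ℝ) ^ 2 - 1) ^ ℓ)).eval t

/-- The normalised associated Legendre function
`i^(m+|m|) √((ℓ + 1/2) (ℓ-m)! / (ℓ+m)!) P_ℓ^m(t)`. -/
def normLegendre (ℓ : ℕ) (m : ℤ) (t : ℝ) : ℂ :=
  Complex.I ^ (m + |m|) *
    ((Real.sqrt (((ℓ : ℝ) + 1 / 2) * (((ℓ : ℤ) - m).toNat.factorial : ℝ) /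
      (((ℓ : ℤ) + m).toNat.factorial : ℝ)) : ℝ) : ℂ) *
    ((assocLegendre ℓ m t : ℝ) : ℂ)

/-- A longitude of a point: the polar angle of its first two coordinates
(the third coordinate is the cosine of the colatitude). -/
def longitude (x : S2) : ℝ := Complex.arg ⟨(x : E3) 0, (x : E3) 1⟩

/-- The spherical harmonic `Y_{ℓ,m} = e^{imφ} / √(2π) · (normalised Legendre)(cos θ)`. -/
def sphHarm (ℓ : ℕ) (m : ℤ) (x : S2) : ℂ :=
  Complex.exp (Complex.I * (m : ℂ) * ((longitude x : ℝ) : ℂ)) /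
      ((Real.sqrt (2 * Real.pi) : ℝ) : ℂ) *
    normLegendre ℓ m ((x : E3) 2)

/-- `λ_ℓ{g} = 2π ∫_{-1}^{1} P_ℓ(t) g(t) dt`. -/
def lam (ℓ : ℕ) (g : ℝ → ℝ) : ℝ :=
  2 * Real.pi * ∫ t in Ioo (-1 : ℝ) 1, legendreP ℓ t * g t

/-- `g` is a weak derivative of `f` on the open interval `(-1, 1)`. -/
def IsWeakDeriv (f g : ℝ → ℝ) : Prop :=
  LocallyIntegrableOn f (Ioo (-1 : ℝ) 1) ∧ LocallyIntegrableOn g (Ioo (-1 : ℝ) 1) ∧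
    ∀ φ : ℝ → ℝ, ContDiff ℝ ∞ φ → HasCompactSupport φ → tsupport φ ⊆ Ioo (-1 : ℝ) 1 →
      ∫ t in Ioo (-1 : ℝ) 1, f t * deriv φ t = -∫ t in Ioo (-1 : ℝ) 1, g t * φ t

/-- The vector field `F` is integrable over the sphere and its integral is `V`. -/
def HasSurfIntegral (F : S2 → Fin 3 → ℂ) (V : Fin 3 → ℂ) : Prop :=
  Integrable F surf ∧ ∫ y, F y ∂surf = V

end SphereCalc

end

noncomputable section

namespace SphereCalc

/-! Write `L = y × ∇` for the vector of infinitesimal rotations. On the sphere `L p = y × ∇_S p` and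
`∇_S p = -y × L p`, and `y - x = (x × y) × x + (x·y - 1) x`. Componentwise, all four formulas
therefore follow from two scalar integrals for an eigenfunction `p` of `L²` with eigenvalue
`-ℓ(ℓ+1)`: the Funk–Hecke formula `∫ g(x·y) p(y) = λ_ℓ{g} p(x)` (`IsEigen.funkHecke`), and `∫
f'(x·y) (x × y)_i p(y) = λ_ℓ{f} (L_i p)(x)` (`IsEigen.hasInt_cross`). The second is formally an
integration by parts, since `L_i` applied to `y ↦ f(x·y)` is `-f'(x·y) (x × y)_i` and `L_i p` is
again an eigenfunction.

For Funk–Hecke, `L²` is symmetric because rotations preserve the measure. Applied to `(x·y)^n`, this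
gives a recurrence for the moments `∫ (x·y)^n p(y)`. The moments of `P_ℓ` obey the same recurrence,
which determines a sequence from its `ℓ`-th term, so the two sequences are proportional.
Concentrating `(1 + t)^n` at `t = 1` identifies the factor as `2π p(x)`. The case `p = 1` is
Archimedes' theorem, which carries the result from powers to integrable kernels.

For a weak derivative, the integration by parts on the sphere is made only with powers. It shows
that `(x × y)_i p(y)` has density `2π (L_i p)(x) R(t)`, where for `ℓ ≥ 1` the polynomial `R` is the
primitive of `-P_ℓ` divisible by `1 - t²`. Moving the derivative from `f` to `R` is one-dimensional
(`IsWeakDeriv.integral_mul_polynomial`); the factor `1 - t²` absorbs both the cutoff and the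
singularity of `f'`.

A spherical harmonic enters only through `exists_sphHarm_eq_pval`: on the sphere it is a multiple of
`(y₀ ± i y₁)^|m| Q(y₂)`, and Rodrigues' differential equation for `Q` makes it an eigenfunction. -/

/-! ### Polynomials on space and infinitesimal rotations -/

open MvPolynomial in
/-- The infinitesimal rotation about the `i`-th coordinate axis, acting on polynomials. -/
def ang (i : Fin 3) : Derivation ℂ (MvPolynomial (Fin 3) ℂ) (MvPolynomial (Fin 3) ℂ) :=
  (X (i + 1) : MvPolynomial (Fin 3) ℂ) • pderiv (i + 2) -
    (X (i + 2) : MvPolynomial (Fin 3) ℂ) • pderiv (i + 1)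

open MvPolynomial in
lemma ang_apply (i : Fin 3) (p : MvPolynomial (Fin 3) ℂ) :
    ang i p = X (i + 1) * pderiv (i + 2) p - X (i + 2) * pderiv (i + 1) p := rfl

/-- A polynomial as a function on Euclidean space. -/
def pval (p : MvPolynomial (Fin 3) ℂ) (v : E3) : ℂ :=
  MvPolynomial.eval (fun i => ((v i : ℝ) : ℂ)) p

/-- A coordinate as a continuous linear functional with complex values. -/
def coordC (i : Fin 3) : E3 →L[ℝ] ℂ :=
  Complex.ofRealCLM.comp (EuclideanSpace.proj i)

lemma coordC_apply (i : Fin 3) (v : E3) : coordC i v = ((v i : ℝ) : ℂ) := rfl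

lemma hasFDerivAt_pval (p : MvPolynomial (Fin 3) ℂ) (v : E3) :
    HasFDerivAt (pval p) (∑ i, pval (MvPolynomial.pderiv i p) v • coordC i) v := by
  induction p using MvPolynomial.induction_on with
  | C a =>
    have e : pval (MvPolynomial.C a) = fun _ => a := by ext w; simp [pval]
    rw [e]
    refine (hasFDerivAt_const (𝕜 := ℝ) a v).congr_fderiv ?_
    ext w
    simp [pval]
  | add p q hp hq =>
    have h := hp.add hq
    have e : pval (p + q) = pval p + pval q := by ext w; simp [pval]
    rw [e]
    refine h.congr_fderiv ?_
    ext w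
    simp [pval, Fin.sum_univ_three]
    ring
  | mul_X p n hp =>
    have h := hp.mul (coordC n).hasFDerivAt
    have e : pval (p * MvPolynomial.X n) = pval p * coordC n := by
      ext w; simp [pval, coordC_apply]
    rw [e]
    refine h.congr_fderiv ?_
    ext w
    fin_cases n <;> simp [pval, Fin.sum_univ_three, coordC_apply, MvPolynomial.pderiv_X,
      Pi.single_apply] <;> ring

lemma contDiff_pval (p : MvPolynomial (Fin 3) ℂ) {n : WithTop ℕ∞} : ContDiff ℝ n (pval p) := by
  induction p using MvPolynomial.induction_on with
  | C a =>
    have e : pval (MvPolynomial.C a) = fun _ => a := by ext w; simp [pval]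
    rw [e]; exact contDiff_const
  | add p q hp hq =>
    have e : pval (p + q) = pval p + pval q := by ext w; simp [pval]
    rw [e]; exact hp.add hq
  | mul_X p i hp =>
    have e : pval (p * MvPolynomial.X i) = pval p * coordC i := by
      ext w; simp [pval, coordC_apply]
    rw [e]; exact hp.mul (coordC i).contDiff

/-! ### Rotations about the axes and invariance of the surface measure -/

/-- The cross product with the `i`-th coordinate vector. -/
def axisMap (i : Fin 3) : E3 →L[ℝ] E3 :=
  (EuclideanSpace.proj (i + 1)).smulRight (EuclideanSpace.single (i + 2) (1 : ℝ)) -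
    (EuclideanSpace.proj (i + 2)).smulRight (EuclideanSpace.single (i + 1) (1 : ℝ))

lemma axisMap_mem_skewAdjoint (i : Fin 3) : axisMap i ∈ skewAdjoint (E3 →L[ℝ] E3) := by
  rw [skewAdjoint.mem_iff, ContinuousLinearMap.star_eq_adjoint, eq_comm,
    ContinuousLinearMap.eq_adjoint_iff]
  intro v w
  fin_cases i <;> simp [axisMap, PiLp.inner_apply, Fin.sum_univ_three, Fin.reduceAdd] <;> ring

instance : NormedAlgebra ℚ (E3 →L[ℝ] E3) := NormedAlgebra.restrictScalars ℚ ℝ _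

/-- The rotation by the angle `θ` about the `i`-th coordinate axis. -/
def axisRot (i : Fin 3) (θ : ℝ) : E3 ≃ₗᵢ[ℝ] E3 :=
  Unitary.linearIsometryEquiv ⟨NormedSpace.exp (θ • axisMap i),
    NormedSpace.exp_mem_unitary_of_mem_skewAdjoint
      (skewAdjoint.smul_mem θ (axisMap_mem_skewAdjoint i))⟩

lemma axisRot_apply (i : Fin 3) (θ : ℝ) (v : E3) :
    axisRot i θ v = NormedSpace.exp (θ • axisMap i) v := rfl

lemma axisRot_zero (i : Fin 3) (v : E3) : axisRot i 0 v = v := by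
  have h : (0 : ℝ) • axisMap i = 0 := by ext w j; simp
  rw [axisRot_apply, h, NormedSpace.exp_zero]; rfl

lemma hasDerivAt_axisRot (i : Fin 3) (θ : ℝ) (v : E3) :
    HasDerivAt (fun t => axisRot i t v) (axisMap i (axisRot i θ v)) θ := by
  have h := hasDerivAt_exp_smul_const' (𝕂 := ℝ) (axisMap i) θ
  exact ((ContinuousLinearMap.apply ℝ E3 v).hasFDerivAt.comp_hasDerivAt θ h)

/-- The chain rule along the rotation flow: `ang i` is its generator. This is what turns invariance
under rotations into identities for `ang i`. -/
lemma hasDerivAt_pval_axisRot (i : Fin 3) (p : MvPolynomial (Fin 3) ℂ) (θ : ℝ) (v : E3) :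
    HasDerivAt (fun t => pval p (axisRot i t v)) (pval (ang i p) (axisRot i θ v)) θ := by
  have h := (hasFDerivAt_pval p (axisRot i θ v)).comp_hasDerivAt θ (hasDerivAt_axisRot i θ v)
  refine h.congr_deriv ?_
  fin_cases i <;>
    simp [Fin.sum_univ_three, coordC_apply, axisMap, ang_apply, pval, Fin.reduceAdd] <;> ring

/-- A linear isometry as a map of the sphere. -/
def sphereMap (U : E3 ≃ₗᵢ[ℝ] E3) (y : S2) : S2 :=
  ⟨U y, by simp⟩

lemma continuous_sphereMap (U : E3 ≃ₗᵢ[ℝ] E3) : Continuous (sphereMap U) :=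
  (U.continuous.comp continuous_subtype_val).subtype_mk _

/-- The surface measure of a set is a multiple of the volume of the cone over it; an isometry maps
cones to cones and preserves volume. -/
lemma measurePreserving_sphereMap (U : E3 ≃ₗᵢ[ℝ] E3) :
    MeasurePreserving (sphereMap U) surf surf := by
  refine ⟨(continuous_sphereMap U).measurable, ?_⟩
  ext s hs
  rw [Measure.map_apply (continuous_sphereMap U).measurable hs, surf,
    Measure.toSphere_apply' _ hs,
    Measure.toSphere_apply' _ ((continuous_sphereMap U).measurable hs)]
  congr 1
  rw [← U.symm.measurePreserving.measure_preimage_emb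
    U.symm.toMeasurableEquiv.measurableEmbedding]
  congr 1
  ext v
  simp only [Set.mem_smul, Set.mem_image, Set.mem_preimage]
  constructor
  · rintro ⟨r, hr, _, ⟨y, hy, rfl⟩, h⟩
    refine ⟨r, hr, _, ⟨sphereMap U y, hy, rfl⟩, ?_⟩
    have := congrArg U h
    simpa [sphereMap] using this
  · rintro ⟨r, hr, _, ⟨y, hy, rfl⟩, rfl⟩
    refine ⟨r, hr, _, ⟨sphereMap U.symm y, ?_, rfl⟩, by simp [sphereMap]⟩
    have : sphereMap U (sphereMap U.symm y) = y := by ext1; simp [sphereMap]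
    simpa [this] using hy

instance : IsFiniteMeasure surf := by unfold surf; infer_instance

instance : surf.IsOpenPosMeasure := by unfold surf; infer_instance

lemma _root_.Continuous.integrable_surf {F : S2 → ℂ} (hF : Continuous F) : Integrable F surf :=
  hF.integrable_of_hasCompactSupport (HasCompactSupport.of_compactSpace F)

lemma continuous_pval_sphere (p : MvPolynomial (Fin 3) ℂ) :
    Continuous (fun y : S2 => pval p y) :=
  (contDiff_pval p (n := 0)).continuous.comp continuous_subtype_val

/-- Infinitesimal rotations have vanishing mean over the sphere. -/
lemma integral_pval_ang (i : Fin 3) (p : MvPolynomial (Fin 3) ℂ) :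
    ∫ y : S2, pval (ang i p) y ∂surf = 0 := by
  obtain ⟨C, hC⟩ := (isCompact_range (continuous_pval_sphere (ang i p))).isBounded.exists_norm_le
  have hC' : ∀ y : S2, ‖pval (ang i p) y‖ ≤ C := fun y => hC _ ⟨y, rfl⟩
  -- The mean of `p` over the rotated sphere is constant in the angle; differentiating it under the
  -- integral at angle `0` produces the mean of `ang i p`.
  have key := (hasDerivAt_integral_of_dominated_loc_of_deriv_le (μ := surf) (𝕜 := ℝ)
    (F := fun t (y : S2) => pval p (sphereMap (axisRot i t) y))
    (F' := fun t (y : S2) => pval (ang i p) (sphereMap (axisRot i t) y))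
    (x₀ := (0 : ℝ)) (s := univ) (bound := fun _ => C) Filter.univ_mem
    (Filter.Eventually.of_forall fun t => ((continuous_pval_sphere p).comp
      (continuous_sphereMap _)).aestronglyMeasurable)
    ((continuous_pval_sphere p).comp (continuous_sphereMap _)).integrable_surf
    ((continuous_pval_sphere _).comp (continuous_sphereMap _)).aestronglyMeasurable
    (Filter.Eventually.of_forall fun y t _ => hC' _)
    (integrable_const C)
    (Filter.Eventually.of_forall fun y t _ => hasDerivAt_pval_axisRot i p t y)).2
  have hconst : ∀ t : ℝ, ∫ y, pval p (sphereMap (axisRot i t) y) ∂surf = ∫ y : S2, pval p y ∂surf := by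
    intro t
    have hm := measurePreserving_sphereMap (axisRot i t)
    have := integral_map (μ := surf) (φ := sphereMap (axisRot i t)) hm.measurable.aemeasurable
      (f := fun y : S2 => pval p y) (continuous_pval_sphere p).aestronglyMeasurable
    rw [hm.map_eq] at this
    exact this.symm
  simp only [hconst] at key
  have h0 := key.unique (hasDerivAt_const (0 : ℝ) _)
  have e : ∀ y : S2, sphereMap (axisRot i 0) y = y := fun y => by
    ext1; exact axisRot_zero i y
  simpa only [e] using h0

/-- Infinitesimal rotations only depend on the values on the sphere. -/
lemma pval_ang_eq_zero {p : MvPolynomial (Fin 3) ℂ} (hp : ∀ y : S2, pval p y = 0) (i : Fin 3)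
    (y : S2) : pval (ang i p) y = 0 := by
  have h := hasDerivAt_pval_axisRot i p 0 y
  have e : (fun t => pval p (axisRot i t y)) = fun _ => 0 := by
    ext t; exact hp (sphereMap (axisRot i t) y)
  rw [e, axisRot_zero] at h
  exact h.unique (hasDerivAt_const _ _)

/-! ### Evaluation rules, commutators and eigenfunctions -/

@[simp] lemma pval_add (p q : MvPolynomial (Fin 3) ℂ) (v : E3) :
    pval (p + q) v = pval p v + pval q v := map_add _ _ _

@[simp] lemma pval_sub (p q : MvPolynomial (Fin 3) ℂ) (v : E3) :
    pval (p - q) v = pval p v - pval q v := map_sub _ _ _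

@[simp] lemma pval_neg (p : MvPolynomial (Fin 3) ℂ) (v : E3) :
    pval (-p) v = -pval p v := map_neg _ _

@[simp] lemma pval_mul (p q : MvPolynomial (Fin 3) ℂ) (v : E3) :
    pval (p * q) v = pval p v * pval q v := map_mul _ _ _

@[simp] lemma pval_pow (p : MvPolynomial (Fin 3) ℂ) (n : ℕ) (v : E3) :
    pval (p ^ n) v = pval p v ^ n := map_pow _ _ _

@[simp] lemma pval_C (a : ℂ) (v : E3) : pval (MvPolynomial.C a) v = a :=
  MvPolynomial.eval_C _

@[simp] lemma pval_zero (v : E3) : pval 0 v = 0 := map_zero _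

@[simp] lemma pval_one (v : E3) : pval 1 v = 1 := map_one _

@[simp] lemma pval_natCast (n : ℕ) (v : E3) : pval (n : MvPolynomial (Fin 3) ℂ) v = n :=
  map_natCast _ _

@[simp] lemma pval_X (i : Fin 3) (v : E3) : pval (MvPolynomial.X i) v = ((v i : ℝ) : ℂ) :=
  MvPolynomial.eval_X _

@[simp] lemma pval_sum {ι : Type*} (s : Finset ι) (p : ι → MvPolynomial (Fin 3) ℂ) (v : E3) :
    pval (∑ i ∈ s, p i) v = ∑ i ∈ s, pval (p i) v := map_sum _ _ _

lemma pderiv_pderiv_comm (i j : Fin 3) (p : MvPolynomial (Fin 3) ℂ) :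
    MvPolynomial.pderiv i (MvPolynomial.pderiv j p) =
      MvPolynomial.pderiv j (MvPolynomial.pderiv i p) := by
  have h : ⁅MvPolynomial.pderiv (R := ℂ) i, MvPolynomial.pderiv (R := ℂ) j⁆ = 0 := by
    refine MvPolynomial.derivation_ext fun k => ?_
    rw [Derivation.commutator_apply]
    simp only [MvPolynomial.pderiv_X, Pi.single_apply]
    split_ifs <;> simp
  have h2 := congrArg (fun D => D p) h
  simp only [Derivation.commutator_apply, Derivation.zero_apply] at h2
  exact sub_eq_zero.mp h2

/-- The commutation relations of `so(3)`, oriented as rewriting rules. -/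
lemma ang_ang_succ (i : Fin 3) (p : MvPolynomial (Fin 3) ℂ) :
    ang i (ang (i + 1) p) = ang (i + 1) (ang i p) - ang (i + 2) p := by
  have h01 := pderiv_pderiv_comm 0 1 p
  have h02 := pderiv_pderiv_comm 0 2 p
  have h12 := pderiv_pderiv_comm 1 2 p
  fin_cases i <;>
    simp [ang_apply, Fin.reduceAdd, MvPolynomial.pderiv_X, h01, h02, h12] <;> ring

/-- The total angular momentum operator `∑ i, ang i ∘ ang i` on polynomials. -/
def angSq (p : MvPolynomial (Fin 3) ℂ) : MvPolynomial (Fin 3) ℂ := ∑ i, ang i (ang i p)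

/-- The Casimir element commutes with the generators. -/
lemma angSq_ang (i : Fin 3) (p : MvPolynomial (Fin 3) ℂ) :
    angSq (ang i p) = ang i (angSq p) := by
  have a0 := fun q => ang_ang_succ 0 q
  have a1 := fun q => ang_ang_succ 1 q
  have a2 := fun q => ang_ang_succ 2 q
  simp only [Fin.reduceAdd] at a0 a1 a2
  fin_cases i <;> simp [angSq, Fin.sum_univ_three, a0, a1, a2] <;> ring

/-- The restriction of the polynomial to the sphere is an eigenfunction of the angular momentum
operator, for the eigenvalue of spherical harmonics of degree `ℓ`. -/
def IsEigen (ℓ : ℕ) (p : MvPolynomial (Fin 3) ℂ) : Prop :=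
  ∀ y : S2, pval (angSq p) y = -((ℓ : ℂ) * (ℓ + 1)) * pval p y

/-- The eigenvalue equation holds only on the sphere. It may still be differentiated by `ang i`,
because rotations are tangent to the sphere (`pval_ang_eq_zero`). -/
lemma IsEigen.ang {ℓ : ℕ} {p : MvPolynomial (Fin 3) ℂ} (hp : IsEigen ℓ p) (i : Fin 3) :
    IsEigen ℓ (ang i p) := by
  intro y
  have h : ∀ z : S2, pval (angSq p + MvPolynomial.C ((ℓ : ℂ) * (ℓ + 1)) * p) z = 0 := by
    intro z
    rw [pval_add, hp z, pval_mul, pval_C]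
    ring
  have h2 := pval_ang_eq_zero h i y
  rw [angSq_ang]
  simp only [map_add, Derivation.leibniz, MvPolynomial.derivation_C, add_zero,
    smul_eq_mul, pval_add, pval_mul, pval_C, mul_zero] at h2
  linear_combination h2

lemma IsEigen.add {ℓ : ℕ} {p q : MvPolynomial (Fin 3) ℂ} (hp : IsEigen ℓ p) (hq : IsEigen ℓ q) :
    IsEigen ℓ (p + q) := by
  intro y
  have e : angSq (p + q) = angSq p + angSq q := by
    simp [angSq, Finset.sum_add_distrib]
  rw [e, pval_add, hp y, hq y, pval_add]
  ring

lemma IsEigen.C_mul {ℓ : ℕ} {p : MvPolynomial (Fin 3) ℂ} (hp : IsEigen ℓ p) (a : ℂ) :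
    IsEigen ℓ (MvPolynomial.C a * p) := by
  intro y
  have e : angSq (MvPolynomial.C a * p) = MvPolynomial.C a * angSq p := by
    simp [angSq, Finset.mul_sum, Derivation.leibniz]
  rw [e, pval_mul, hp y, pval_mul]
  ring

/-! ### Zonal polynomials -/

lemma sphere_sq (x : S2) : ((x : E3) 0) ^ 2 + ((x : E3) 1) ^ 2 + ((x : E3) 2) ^ 2 = 1 := by
  have h : ‖(x : E3)‖ = 1 := by simp
  have h2 := EuclideanSpace.norm_sq_eq (x : E3)
  rw [h] at h2
  simp only [Fin.sum_univ_three, Real.norm_eq_abs, sq_abs] at h2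
  linarith

lemma sphere_sq_complex (x : S2) :
    (((x : E3) 0 : ℝ) : ℂ) ^ 2 + (((x : E3) 1 : ℝ) : ℂ) ^ 2 + (((x : E3) 2 : ℝ) : ℂ) ^ 2 = 1 := by
  have h := congrArg Complex.ofReal (sphere_sq x)
  push_cast at h
  exact h

lemma dotS_eq (x y : S2) : dotS x y =
    (x : E3) 0 * (y : E3) 0 + (x : E3) 1 * (y : E3) 1 + (x : E3) 2 * (y : E3) 2 := by
  simp [dotS, PiLp.inner_apply, Fin.sum_univ_three]
  ring

/-- The linear polynomial `y ↦ x · y`. -/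
def dotPoly (x : S2) : MvPolynomial (Fin 3) ℂ :=
  ∑ i, MvPolynomial.C (((x : E3) i : ℝ) : ℂ) * MvPolynomial.X i

lemma pval_dotPoly (x y : S2) : pval (dotPoly x) y = (dotS x y : ℝ) := by
  simp [dotPoly, dotS_eq, Fin.sum_univ_three]

/-- The component of `x × y`. -/
def crossS (i : Fin 3) (x y : S2) : ℝ :=
  (x : E3) (i + 1) * (y : E3) (i + 2) - (x : E3) (i + 2) * (y : E3) (i + 1)

lemma pval_ang_dotPoly (i : Fin 3) (x y : S2) :
    pval (ang i (dotPoly x)) y = -(crossS i x y : ℝ) := by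
  fin_cases i <;>
    simp [dotPoly, ang_apply, crossS, Fin.sum_univ_three, Fin.reduceAdd, MvPolynomial.pderiv_X] <;> ring

/-- Lagrange's identity. It is the source of the weight `√(1 - t²)` imposed on `f'`. -/
lemma sum_crossS_sq (x y : S2) : ∑ i, crossS i x y ^ 2 = 1 - dotS x y ^ 2 := by
  have hx := sphere_sq x
  have hy := sphere_sq y
  simp only [crossS, Fin.sum_univ_three, Fin.reduceAdd, dotS_eq]
  linear_combination ((y : E3) 0 ^ 2 + (y : E3) 1 ^ 2 + (y : E3) 2 ^ 2) * hx + hy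

lemma abs_crossS_le (i : Fin 3) (x y : S2) : |crossS i x y| ≤ Real.sqrt (1 - dotS x y ^ 2) := by
  apply Real.abs_le_sqrt
  rw [← sum_crossS_sq]
  exact Finset.single_le_sum (f := fun i => crossS i x y ^ 2) (fun j _ => sq_nonneg _)
    (Finset.mem_univ i)

lemma angSq_dotPoly (x : S2) : angSq (dotPoly x) = -(2 * dotPoly x) := by
  simp [dotPoly, angSq, ang_apply, Fin.sum_univ_three, Fin.reduceAdd, MvPolynomial.pderiv_X,
      Pi.single_apply]
  ring

/-- On functions of `t = x·y`, `L²` acts as Legendre's operator `φ ↦ (1 - t²) φ'' - 2t φ'`. The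
truncated exponent for `n < 2` is harmless, as its coefficient vanishes. -/
lemma pval_angSq_dotPoly_pow (x y : S2) (n : ℕ) :
    pval (angSq (dotPoly x ^ n)) y =
      n * (n - 1) * (dotS x y : ℂ) ^ (n - 2) - n * (n + 1) * (dotS x y : ℂ) ^ n := by
  have hsq : ∑ i, (crossS i x y : ℂ) ^ 2 = 1 - (dotS x y : ℂ) ^ 2 := by
    exact_mod_cast sum_crossS_sq x y
  rcases n with _ | _ | n
  · simp [angSq]
  · have h2 : pval 2 y = 2 := pval_natCast 2 y
    simp [angSq_dotPoly, pval_dotPoly, h2]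
    norm_num
  · have h : angSq (dotPoly x ^ (n + 2)) =
        ((n + 2 : ℕ) : MvPolynomial (Fin 3) ℂ) * ((n + 1 : ℕ) : MvPolynomial (Fin 3) ℂ) *
          dotPoly x ^ n * ∑ i, ang i (dotPoly x) ^ 2 +
        ((n + 2 : ℕ) : MvPolynomial (Fin 3) ℂ) * dotPoly x ^ (n + 1) * angSq (dotPoly x) := by
      simp only [angSq, Derivation.leibniz_pow, Finset.mul_sum, ← Finset.sum_add_distrib]
      refine Finset.sum_congr rfl fun i _ => ?_
      simp only [Derivation.leibniz, Derivation.leibniz_pow, smul_eq_mul, nsmul_eq_mul,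
        Nat.add_sub_cancel, Derivation.map_natCast, mul_zero, show n + 2 - 1 = n + 1 by omega]
      ring
    rw [h, angSq_dotPoly]
    simp only [pval_add, pval_mul, pval_natCast, pval_pow, pval_sum, pval_dotPoly, pval_neg,
      pval_ang_dotPoly, neg_sq, hsq]
    have h2 : pval 2 y = 2 := pval_natCast 2 y
    rw [h2]
    push_cast
    ring

/-! ### Integration by parts on the sphere and the moment recurrence -/

lemma integral_pval_mul_ang (i : Fin 3) (p q : MvPolynomial (Fin 3) ℂ) :
    ∫ y : S2, pval p y * pval (ang i q) y ∂surf =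
      -∫ y : S2, pval (ang i p) y * pval q y ∂surf := by
  have h := integral_pval_ang i (p * q)
  have e : ∀ y : S2, pval (ang i (p * q)) y =
      pval p y * pval (ang i q) y + pval (ang i p) y * pval q y := by
    intro y
    simp [Derivation.leibniz]
    ring
  simp only [e] at h
  rw [integral_add] at h
  · exact eq_neg_of_add_eq_zero_left h
  · exact ((continuous_pval_sphere _).mul (continuous_pval_sphere _)).integrable_surf
  · exact ((continuous_pval_sphere _).mul (continuous_pval_sphere _)).integrable_surf

lemma integral_pval_mul_angSq (p q : MvPolynomial (Fin 3) ℂ) :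
    ∫ y : S2, pval p y * pval (angSq q) y ∂surf =
      ∫ y : S2, pval (angSq p) y * pval q y ∂surf := by
  simp only [angSq, pval_sum, Finset.mul_sum, Finset.sum_mul]
  rw [integral_finsetSum, integral_finsetSum]
  · exact Finset.sum_congr rfl fun i _ => by
      rw [integral_pval_mul_ang, integral_pval_mul_ang, neg_neg]
  · exact fun i _ => ((continuous_pval_sphere _).mul (continuous_pval_sphere _)).integrable_surf
  · exact fun i _ => ((continuous_pval_sphere _).mul (continuous_pval_sphere _)).integrable_surf

/-- The moments `∫ (x · y)^n p(y) dΩ(y)`. -/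
def moment (p : MvPolynomial (Fin 3) ℂ) (x : S2) (n : ℕ) : ℂ :=
  ∫ y : S2, (dotS x y : ℂ) ^ n * pval p y ∂surf

lemma continuous_dotS (x : S2) : Continuous (dotS x) := by
  unfold dotS; fun_prop

/-- Symmetry of `L²` between `(x·y)^n` and `p`, with Legendre's operator on one side and the
eigenvalue on the other. -/
lemma moment_rec {ℓ : ℕ} {p : MvPolynomial (Fin 3) ℂ} (hp : IsEigen ℓ p) (x : S2) (n : ℕ) :
    (n * (n - 1) : ℂ) * moment p x (n - 2) =
      (n * (n + 1) - ℓ * (ℓ + 1) : ℂ) * moment p x n := by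
  have h := integral_pval_mul_angSq (dotPoly x ^ n) p
  have hint : ∀ k : ℕ, Integrable (fun y : S2 => (dotS x y : ℂ) ^ k * pval p y) surf := fun k =>
    (((Complex.continuous_ofReal.comp (continuous_dotS x)).pow k).mul
      (continuous_pval_sphere p)).integrable_surf
  have e1 : ∫ y : S2, pval (dotPoly x ^ n) y * pval (angSq p) y ∂surf =
      -((ℓ : ℂ) * (ℓ + 1)) * moment p x n := by
    rw [moment, ← integral_const_mul]
    congr 1 with y
    rw [hp y, pval_pow, pval_dotPoly]
    ring
  have e2 : ∫ y : S2, pval (angSq (dotPoly x ^ n)) y * pval p y ∂surf =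
      n * (n - 1) * moment p x (n - 2) - n * (n + 1) * moment p x n := by
    rw [moment, moment, ← integral_const_mul, ← integral_const_mul, ← integral_sub
      ((hint _).const_mul _) ((hint _).const_mul _)]
    congr 1 with y
    rw [pval_angSq_dotPoly_pow]
    ring
  rw [e1, e2] at h
  linear_combination -h

/-- Sequences satisfying the moment recurrence of degree `ℓ` are determined by their `ℓ`-th
term. -/
lemma eq_zero_of_moment_rec {ℓ : ℕ} {a : ℕ → ℂ}
    (ha : ∀ n : ℕ, (n * (n - 1) : ℂ) * a (n - 2) = (n * (n + 1) - ℓ * (ℓ + 1) : ℂ) * a n)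
    (h0 : a ℓ = 0) (n : ℕ) : a n = 0 := by
  induction n using Nat.strong_induction_on with
  | _ n ih =>
    rcases eq_or_ne n ℓ with rfl | hn
    · exact h0
    have hne : (n * (n + 1) - ℓ * (ℓ + 1) : ℂ) ≠ 0 := by
      have e : (n * (n + 1) - ℓ * (ℓ + 1) : ℂ) = ((n : ℂ) - ℓ) * ((n + ℓ + 1 : ℕ) : ℂ) := by
        push_cast; ring
      rw [e]
      exact mul_ne_zero (sub_ne_zero.mpr (by exact_mod_cast hn)) (Nat.cast_ne_zero.mpr (by omega))
    have h := ha n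
    -- For `n = 0, 1` the recurrence has no predecessor: the coefficient is zero, whatever the
    -- truncated index.
    have hz : (n * (n - 1) : ℂ) * a (n - 2) = 0 := by
      rcases n with _ | _ | n
      · simp
      · simp
      · rw [ih (n + 2 - 2) (by omega), mul_zero]
    rw [hz] at h
    exact (mul_eq_zero.mp h.symm).resolve_left hne

/-! ### Rodrigues' formula and Legendre moments -/

/-- The iterated derivative `(d/dt)^n (t² - 1)^ℓ` of Rodrigues' formula. -/
def rodrigues (ℓ n : ℕ) : Polynomial ℝ :=
  Polynomial.derivative^[n] ((Polynomial.X ^ 2 - 1) ^ ℓ)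

lemma derivative_rodrigues (ℓ n : ℕ) :
    Polynomial.derivative (rodrigues ℓ n) = rodrigues ℓ (n + 1) := by
  rw [rodrigues, rodrigues, Function.iterate_succ_apply']

open Polynomial in
lemma rodrigues_ode_zero (ℓ : ℕ) :
    (1 - X ^ 2) * rodrigues ℓ 1 + 2 * (ℓ : ℝ[X]) * X * rodrigues ℓ 0 = 0 := by
  rcases ℓ with _ | ℓ
  · simp [rodrigues]
  · simp only [rodrigues, Function.iterate_one, Function.iterate_zero, id, derivative_pow,
      derivative_sub, derivative_X, derivative_one, Nat.add_sub_cancel, Polynomial.C_eq_natCast]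
    push_cast
    ring

-- Repeated differentiation of the first-order equation satisfied by `w = (t² - 1)^ℓ`, namely `(1 -
-- t²) w' + 2ℓ t w = 0`.
open Polynomial in
lemma rodrigues_ode (ℓ n : ℕ) :
    (1 - X ^ 2) * rodrigues ℓ (n + 2) + 2 * ((ℓ : ℝ[X]) - 1 - (n : ℝ[X])) * X * rodrigues ℓ (n + 1) +
      ((n : ℝ[X]) + 1) * (2 * (ℓ : ℝ[X]) - (n : ℝ[X])) * rodrigues ℓ n = 0 := by
  induction n with
  | zero =>
    have h := congrArg derivative (rodrigues_ode_zero ℓ)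
    have h2 : derivative (2 : ℝ[X]) = 0 := derivative_ofNat 2
    simp only [derivative_add, derivative_mul, derivative_rodrigues, derivative_sub,
      derivative_one, derivative_X_pow, derivative_X, derivative_natCast, derivative_zero, h2,
      Nat.cast_ofNat, map_ofNat] at h
    simp only [Nat.cast_zero, zero_add, Nat.reduceAdd] at h ⊢
    linear_combination h
  | succ n ih =>
    have h := congrArg derivative ih
    have h2 : derivative (2 : ℝ[X]) = 0 := derivative_ofNat 2
    simp only [derivative_add, derivative_mul, derivative_rodrigues, derivative_sub,
      derivative_one, derivative_X_pow, derivative_X, derivative_natCast, derivative_zero, h2,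
      Nat.cast_ofNat, map_ofNat] at h
    push_cast
    simp only [add_assoc, Nat.reduceAdd] at h ⊢
    linear_combination h

/-- The Legendre polynomial as a formal polynomial. -/
def legendrePoly (ℓ : ℕ) : Polynomial ℝ :=
  Polynomial.C (1 / (2 ^ ℓ * (ℓ.factorial : ℝ))) * rodrigues ℓ ℓ

lemma eval_legendrePoly (ℓ : ℕ) (t : ℝ) : (legendrePoly ℓ).eval t = legendreP ℓ t := by
  simp [legendrePoly, legendreP, rodrigues]

lemma continuous_legendreP (ℓ : ℕ) : Continuous (legendreP ℓ) := by
  simpa only [eval_legendrePoly] using (legendrePoly ℓ).continuous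

lemma legendreP_zero (t : ℝ) : legendreP 0 t = 1 := by simp [legendreP]

lemma legendreP_one (ℓ : ℕ) : legendreP ℓ 1 = 1 := by
  -- Factor `(t² - 1)^ℓ = (t - 1)^ℓ (t + 1)^ℓ`. At `t = 1` only the term with all derivatives on the
  -- first factor survives, giving `ℓ! 2^ℓ`.
  have h := Polynomial.aeval_iterate_derivative_self (A := ℝ)
    ((Polynomial.X ^ 2 - 1 : Polynomial ℝ) ^ ℓ) ℓ (1 : ℝ) (p' := (Polynomial.X + 1) ^ ℓ) (by
      rw [← mul_pow]
      simp
      ring)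
  simp only [Polynomial.coe_aeval_eq_eval, Polynomial.eval_pow, Polynomial.eval_add,
    Polynomial.eval_X, Polynomial.eval_one, nsmul_eq_mul] at h
  rw [legendreP, h]
  have : (ℓ.factorial : ℝ) ≠ 0 := by positivity
  field_simp
  norm_num

open Polynomial in
lemma legendrePoly_ode (ℓ : ℕ) :
    (1 - X ^ 2) * derivative (derivative (legendrePoly ℓ)) - 2 * X * derivative (legendrePoly ℓ) +
      (ℓ : ℝ[X]) * ((ℓ : ℝ[X]) + 1) * legendrePoly ℓ = 0 := by
  have h := rodrigues_ode ℓ ℓ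
  simp only [legendrePoly, derivative_C_mul, derivative_rodrigues]
  linear_combination C (1 / (2 ^ ℓ * (ℓ.factorial : ℝ))) * h

lemma integral_eval_derivative (q : Polynomial ℝ) (a b : ℝ) :
    ∫ t in a..b, (Polynomial.derivative q).eval t = q.eval b - q.eval a :=
  intervalIntegral.integral_eq_sub_of_hasDerivAt (fun t _ => q.hasDerivAt t)
    ((Polynomial.derivative q).continuous.intervalIntegrable _ _)

/-- The moments of the Legendre polynomials. -/
def legendreMoment (ℓ n : ℕ) : ℝ := ∫ t in (-1 : ℝ)..1, t ^ n * legendreP ℓ t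

-- Green's identity for Legendre's operator: the boundary bracket `(1 - t²)(u' P - u P')` with `u =
-- t^n` vanishes at `±1`.
open Polynomial in
lemma legendreMoment_rec (ℓ n : ℕ) :
    (n * (n - 1) : ℝ) * legendreMoment ℓ (n - 2) =
      (n * (n + 1) - ℓ * (ℓ + 1) : ℝ) * legendreMoment ℓ n := by
  set P := legendrePoly ℓ with hP
  have h := integral_eval_derivative
    ((1 - X ^ 2) * (derivative (X ^ n) * P - X ^ n * derivative P)) (-1) 1
  have e : ∀ t : ℝ, (derivative
      ((1 - X ^ 2) * (derivative (X ^ n) * P - X ^ n * derivative P))).eval t =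
      (n * (n - 1) : ℝ) * (t ^ (n - 2) * legendreP ℓ t) -
        (n * (n + 1) - ℓ * (ℓ + 1) : ℝ) * (t ^ n * legendreP ℓ t) := by
    intro t
    have ho := congrArg (eval t) (legendrePoly_ode ℓ)
    rw [← hP] at ho
    rw [← eval_legendrePoly, ← hP]
    rcases n with _ | _ | n
    · simp at ho ⊢
      linear_combination -ho
    · simp at ho ⊢
      linear_combination -t * ho
    · simp at ho ⊢
      linear_combination -t ^ (n + 2) * ho
  simp only [e] at h
  have hc := continuous_legendreP ℓ
  rw [intervalIntegral.integral_sub, intervalIntegral.integral_const_mul,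
    intervalIntegral.integral_const_mul] at h
  · simp only [eval_mul, eval_sub, eval_one, eval_pow, eval_X] at h
    rw [legendreMoment, legendreMoment]
    linear_combination h
  · exact Continuous.intervalIntegrable (by fun_prop) _ _
  · exact Continuous.intervalIntegrable (by fun_prop) _ _

lemma legendreMoment_zero_zero : legendreMoment 0 0 = 2 := by
  simp [legendreMoment, legendreP_zero]
  norm_num

/-! ### Spherical moments against Legendre moments -/

/-- The difference of the two sides solves the recurrence and vanishes at `n = ℓ`. The
cross-multiplied form needs no division by `legendreMoment ℓ ℓ`, whose non-vanishing itself depends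
on the case `ℓ = 0` through Archimedes' theorem. -/
lemma moment_mul_legendreMoment {ℓ : ℕ} {p : MvPolynomial (Fin 3) ℂ} (hp : IsEigen ℓ p) (x : S2)
    (n : ℕ) : moment p x n * legendreMoment ℓ ℓ = moment p x ℓ * legendreMoment ℓ n := by
  rw [← sub_eq_zero]
  refine eq_zero_of_moment_rec (ℓ := ℓ)
    (a := fun n => moment p x n * legendreMoment ℓ ℓ - moment p x ℓ * legendreMoment ℓ n)
    (fun k => ?_) (sub_self _) n
  have h1 := moment_rec hp x k
  have h2 := congrArg Complex.ofReal (legendreMoment_rec ℓ k)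
  push_cast at h2
  linear_combination (legendreMoment ℓ ℓ : ℂ) * h1 - moment p x ℓ * h2

lemma surf_real_univ : surf.real univ = 4 * Real.pi := by
  have h := EuclideanSpace.volume_ball_fin_three (0 : E3) 1
  rw [surf, Measure.toSphere_real_apply_univ, Measure.real, h]
  have : 0 ≤ Real.pi * 4 / 3 := by positivity
  simp only [ENNReal.ofReal_one, one_pow, one_mul, ENNReal.toReal_ofReal this,
    finrank_euclideanSpace, Fintype.card_fin]
  push_cast
  ring

/-- Archimedes' theorem for the moments of a coordinate. -/
lemma moment_one (x : S2) (n : ℕ) : moment 1 x n = 2 * Real.pi * legendreMoment 0 n := by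
  have h1 : IsEigen 0 1 := by intro y; simp [angSq]
  have h := moment_mul_legendreMoment h1 x n
  have h0 : moment 1 x 0 = 4 * Real.pi := by
    simp [moment, surf_real_univ]
  rw [legendreMoment_zero_zero, h0] at h
  push_cast at h
  linear_combination h / 2

lemma dotS_mem_Icc (x y : S2) : dotS x y ∈ Icc (-1 : ℝ) 1 := by
  have h := abs_real_inner_le_norm (x : E3) (y : E3)
  have hx : ‖(x : E3)‖ = 1 := by simp
  have hy : ‖(y : E3)‖ = 1 := by simp
  rw [hx, hy, one_mul] at h
  exact abs_le.mp h

lemma dotS_self (x : S2) : dotS x x = 1 := by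
  simp [dotS]

lemma dotS_lt_one {x y : S2} (h : y ≠ x) : dotS x y < 1 := by
  refine (inner_lt_one_iff_real_of_norm_eq_one (by simp) (by simp)).mpr fun e => h ?_
  exact Subtype.ext e.symm

/-! ### Densities with respect to `x·y` and the Funk–Hecke formula -/

/-- The function `h` on the sphere has the density `K` with respect to the variable `x · y`,
as far as moments are concerned. -/
def HasDensity (x : S2) (h : S2 → ℂ) (K : ℝ → ℂ) : Prop :=
  ∀ n : ℕ, ∫ y, (dotS x y : ℂ) ^ n * h y ∂surf = ∫ t in Ioo (-1 : ℝ) 1, (t : ℂ) ^ n * K t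

lemma _root_.Continuous.integrableOn_Ioo {E : Type*} [NormedAddCommGroup E] {K : ℝ → E}
    (hK : Continuous K) (a b : ℝ) : IntegrableOn K (Ioo a b) :=
  (hK.integrableOn_Icc (a := a) (b := b)).mono_set Ioo_subset_Icc_self

lemma HasDensity.polynomial {x : S2} {h : S2 → ℂ} {K : ℝ → ℂ} (hd : HasDensity x h K)
    (hh : Continuous h) (hK : Continuous K) (q : Polynomial ℝ) :
    ∫ y, ((q.eval (dotS x y) : ℝ) : ℂ) * h y ∂surf = ∫ t in Ioo (-1 : ℝ) 1, ((q.eval t : ℝ) : ℂ) * K t := by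
  have hc := continuous_dotS x
  induction q using Polynomial.induction_on' with
  | add p q hp hq =>
    simp only [Polynomial.eval_add, Complex.ofReal_add, add_mul]
    rw [integral_add, integral_add, hp, hq]
    · exact Continuous.integrableOn_Ioo (by fun_prop) _ _
    · exact Continuous.integrableOn_Ioo (by fun_prop) _ _
    · exact Continuous.integrable_surf (by fun_prop)
    · exact Continuous.integrable_surf (by fun_prop)
  | monomial n a =>
    simp only [Polynomial.eval_monomial, Complex.ofReal_mul, Complex.ofReal_pow, mul_assoc]
    rw [integral_const_mul, integral_const_mul, hd n]

lemma integral_Ioo_eq {E : Type*} [NormedAddCommGroup E] [NormedSpace ℝ E] (F : ℝ → E) :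
    ∫ t in Ioo (-1 : ℝ) 1, F t = ∫ t in (-1 : ℝ)..1, F t := by
  rw [intervalIntegral.integral_of_le (by norm_num), integral_Ioc_eq_integral_Ioo]

lemma ofReal_legendreMoment (ℓ n : ℕ) :
    (legendreMoment ℓ n : ℂ) = ∫ t in Ioo (-1 : ℝ) 1, (t : ℂ) ^ n * (legendreP ℓ t : ℂ) := by
  rw [legendreMoment, ← integral_Ioo_eq, ← integral_complex_ofReal]
  simp

/-- The weight `1 + x·y` is non-negative and has its only maximum at `y = x`, so its normalised
powers form an approximate identity there. -/
lemma tendsto_peak_sphere (x : S2) {h : S2 → ℂ} (hh : Continuous h) :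
    Filter.Tendsto (fun n : ℕ => (∫ y, (1 + dotS x y) ^ n ∂surf)⁻¹ •
      ∫ y, (1 + dotS x y) ^ n • h y ∂surf) Filter.atTop (nhds (h x)) := by
  have hc := continuous_dotS x
  have := tendsto_setIntegral_pow_smul_of_unique_maximum_of_isCompact_of_continuousOn
    (μ := surf) (s := univ) (c := fun y => 1 + dotS x y) (x₀ := x) (g := h) isCompact_univ
    (by fun_prop) (fun y _ hy => by
      have := dotS_lt_one hy
      have h1 := dotS_self x
      simp only [h1]; linarith) (fun y _ => by linarith [(dotS_mem_Icc x y).1])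
    (by simp [dotS_self]) (by simp) hh.continuousOn
  simpa using this

lemma tendsto_peak_interval {K : ℝ → ℂ} (hK : Continuous K) :
    Filter.Tendsto (fun n : ℕ => (∫ t in Ioo (-1 : ℝ) 1, (1 + t) ^ n)⁻¹ •
      ∫ t in Ioo (-1 : ℝ) 1, (1 + t) ^ n • K t) Filter.atTop (nhds (K 1)) := by
  have := tendsto_setIntegral_pow_smul_of_unique_maximum_of_isCompact_of_continuousOn
    (μ := volume) (s := Icc (-1 : ℝ) 1) (c := fun t => 1 + t) (x₀ := 1) (g := K) isCompact_Icc
    (by fun_prop) (fun y hy hy' => by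
      have := lt_of_le_of_ne hy.2 hy'
      linarith) (fun y hy => by linarith [hy.1])
    (by norm_num) (by rw [interior_Icc, closure_Ioo (by norm_num)]; simp) hK.continuousOn
  simpa only [integral_Icc_eq_integral_Ioo] using this

lemma hasDensity_one (x : S2) : HasDensity x 1 (fun _ => 2 * Real.pi) := by
  intro n
  have h := moment_one x n
  rw [ofReal_legendreMoment, ← integral_const_mul] at h
  simp only [moment, pval_one, legendreP_zero] at h
  simp only [Pi.one_apply, h]
  congr 1 with t
  push_cast
  ring

lemma integral_peak_sphere (x : S2) (n : ℕ) :
    ∫ y, (1 + dotS x y) ^ n ∂surf = 2 * Real.pi * ∫ t in Ioo (-1 : ℝ) 1, (1 + t) ^ n := by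
  have h := (hasDensity_one x).polynomial continuous_one continuous_const
    ((1 + Polynomial.X) ^ n)
  simp only [Polynomial.eval_pow, Polynomial.eval_add, Polynomial.eval_one, Polynomial.eval_X,
    Pi.one_apply, mul_one] at h
  rw [integral_mul_const, integral_complex_ofReal, integral_complex_ofReal] at h
  have h2 : ((∫ y, (1 + dotS x y) ^ n ∂surf : ℝ) : ℂ) =
      ((2 * Real.pi * ∫ t in Ioo (-1 : ℝ) 1, (1 + t) ^ n : ℝ) : ℂ) := by
    rw [h]; push_cast; ring
  exact_mod_cast h2

/-- A density determines the value at the centre. -/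
lemma HasDensity.apply_one {x : S2} {h : S2 → ℂ} {K : ℝ → ℂ} (hd : HasDensity x h K)
    (hh : Continuous h) (hK : Continuous K) : K 1 = 2 * Real.pi * h x := by
  have h1 := (tendsto_peak_sphere x hh).const_mul (2 * Real.pi : ℂ)
  have h2 := tendsto_peak_interval hK
  refine tendsto_nhds_unique h2 (h1.congr fun n => ?_)
  have h3 := hd.polynomial hh hK ((1 + Polynomial.X) ^ n)
  simp only [Polynomial.eval_pow, Polynomial.eval_add, Polynomial.eval_one,
    Polynomial.eval_X] at h3
  simp only [Complex.real_smul, integral_peak_sphere, h3, mul_inv, Complex.ofReal_mul,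
    Complex.ofReal_inv, Complex.ofReal_ofNat]
  have : (Real.pi : ℂ) ≠ 0 := by exact_mod_cast Real.pi_ne_zero
  field_simp

lemma legendreMoment_self_ne_zero (ℓ : ℕ) : legendreMoment ℓ ℓ ≠ 0 := by
  intro h0
  have hz : ∀ n, (legendreMoment ℓ n : ℂ) = 0 := eq_zero_of_moment_rec (ℓ := ℓ)
    (fun k => by exact_mod_cast legendreMoment_rec ℓ k) (by exact_mod_cast h0)
  have x : S2 := ⟨EuclideanSpace.single 0 1, by simp⟩
  -- If this moment vanished, all would, and `P_ℓ` would be a density of the zero function;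
  -- evaluation at `1` contradicts `P_ℓ(1) = 1`.
  have hd : HasDensity x 0 (fun t => (legendreP ℓ t : ℂ)) := by
    intro n
    rw [← ofReal_legendreMoment, hz n]
    simp
  have h1 := hd.apply_one continuous_zero
    (Complex.continuous_ofReal.comp (continuous_legendreP ℓ))
  simp [legendreP_one] at h1

/-- The Funk–Hecke formula for moments. -/
theorem IsEigen.hasDensity {ℓ : ℕ} {p : MvPolynomial (Fin 3) ℂ} (hp : IsEigen ℓ p) (x : S2) :
    HasDensity x (fun y => pval p y) (fun t => 2 * Real.pi * pval p x * legendreP ℓ t) := by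
  have hb : (legendreMoment ℓ ℓ : ℂ) ≠ 0 := by exact_mod_cast legendreMoment_self_ne_zero ℓ
  have hm := moment_mul_legendreMoment hp x
  have hd : HasDensity x (fun y => pval p y)
      (fun t => moment p x ℓ / legendreMoment ℓ ℓ * legendreP ℓ t) := by
    intro n
    simp only [mul_left_comm _ (moment p x ℓ / legendreMoment ℓ ℓ : ℂ)]
    rw [integral_const_mul, ← ofReal_legendreMoment]
    have := hm n
    rw [moment] at this
    field_simp
    exact this
  have hP := continuous_legendreP ℓ
  have h1 := hd.apply_one (continuous_pval_sphere p) (by fun_prop)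
  rw [legendreP_one, Complex.ofReal_one, mul_one] at h1
  rwa [h1] at hd

/-! ### From moments to integrable zonal kernels -/

/-- Densities represent integrals of continuous functions of `x · y`. -/
lemma HasDensity.continuous {x : S2} {h : S2 → ℂ} {K : ℝ → ℂ} (hd : HasDensity x h K)
    (hh : Continuous h) (hK : Continuous K) {φ : ℝ → ℝ} (hφ : Continuous φ) :
    ∫ y, (φ (dotS x y) : ℂ) * h y ∂surf = ∫ t in Ioo (-1 : ℝ) 1, (φ t : ℂ) * K t := by
  have hc := continuous_dotS x
  set M : ℝ := (∫ y, ‖h y‖ ∂surf) + ∫ t in Ioo (-1 : ℝ) 1, ‖K t‖ with hM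
  have hM0 : 0 ≤ M := add_nonneg (integral_nonneg fun _ => norm_nonneg _)
    (integral_nonneg fun _ => norm_nonneg _)
  have key : ∀ ε > 0, ‖(∫ y, (φ (dotS x y) : ℂ) * h y ∂surf) -
      ∫ t in Ioo (-1 : ℝ) 1, (φ t : ℂ) * K t‖ ≤ ε * M := by
    intro ε hε
    obtain ⟨q, hq⟩ := exists_polynomial_near_of_continuousOn (-1) 1 φ hφ.continuousOn ε hε
    have hp := hd.polynomial hh hK q
    have e1 : (∫ y, (φ (dotS x y) : ℂ) * h y ∂surf) - ∫ y, ((q.eval (dotS x y) : ℝ) : ℂ) * h y ∂surf =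
        ∫ y, ((φ (dotS x y) - q.eval (dotS x y) : ℝ) : ℂ) * h y ∂surf := by
      rw [← integral_sub]
      · simp [sub_mul]
      · exact Continuous.integrable_surf (by fun_prop)
      · exact Continuous.integrable_surf (by fun_prop)
    have e2 : (∫ t in Ioo (-1 : ℝ) 1, (φ t : ℂ) * K t) - ∫ t in Ioo (-1 : ℝ) 1, ((q.eval t : ℝ) : ℂ) * K t =
        ∫ t in Ioo (-1 : ℝ) 1, ((φ t - q.eval t : ℝ) : ℂ) * K t := by
      rw [← integral_sub]
      · simp [sub_mul]
      · exact Continuous.integrableOn_Ioo (by fun_prop) _ _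
      · exact Continuous.integrableOn_Ioo (by fun_prop) _ _
    have b1 : ‖∫ y, ((φ (dotS x y) - q.eval (dotS x y) : ℝ) : ℂ) * h y ∂surf‖ ≤
        ε * ∫ y, ‖h y‖ ∂surf := by
      rw [← integral_const_mul]
      refine norm_integral_le_of_norm_le (hh.integrable_surf.norm.const_mul ε)
        (Filter.Eventually.of_forall fun y => ?_)
      rw [norm_mul, Complex.norm_real, Real.norm_eq_abs, abs_sub_comm]
      gcongr
      exact (hq _ (dotS_mem_Icc x y)).le
    have b2 : ‖∫ t in Ioo (-1 : ℝ) 1, ((φ t - q.eval t : ℝ) : ℂ) * K t‖ ≤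
        ε * ∫ t in Ioo (-1 : ℝ) 1, ‖K t‖ := by
      rw [← integral_const_mul]
      refine norm_integral_le_of_norm_le ((hK.norm.integrableOn_Ioo _ _).const_mul ε)
        ((ae_restrict_mem measurableSet_Ioo).mono fun t ht => ?_)
      rw [norm_mul, Complex.norm_real, Real.norm_eq_abs, abs_sub_comm]
      gcongr
      exact (hq _ (Ioo_subset_Icc_self ht)).le
    calc _ = ‖(∫ y, ((φ (dotS x y) - q.eval (dotS x y) : ℝ) : ℂ) * h y ∂surf) -
          ∫ t in Ioo (-1 : ℝ) 1, ((φ t - q.eval t : ℝ) : ℂ) * K t‖ := by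
            rw [← e1, ← e2, hp]; congr 1; ring
      _ ≤ _ := (norm_sub_le _ _).trans (by rw [hM, mul_add]; exact add_le_add b1 b2)
  rw [← sub_eq_zero, ← norm_le_zero_iff]
  refine le_of_forall_pos_le_add fun δ hδ => ?_
  refine (key (δ / (M + 1)) (by positivity)).trans ?_
  rw [zero_add, div_mul_eq_mul_div, div_le_iff₀ (by positivity)]
  nlinarith

/-- Archimedes' theorem: the variable `x · y` is uniformly distributed. -/
lemma measurePreserving_dotS (x : S2) :
    MeasurePreserving (dotS x) surf
      (ENNReal.ofReal (2 * Real.pi) • volume.restrict (Ioo (-1 : ℝ) 1)) := by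
  have hm := (continuous_dotS x).measurable
  refine ⟨hm, ?_⟩
  have : IsFiniteMeasure (Measure.map (dotS x) surf) := Measure.isFiniteMeasure_map _ _
  have : IsFiniteMeasure (ENNReal.ofReal (2 * Real.pi) • volume.restrict (Ioo (-1 : ℝ) 1)) :=
    Measure.smul_finite _ ENNReal.ofReal_ne_top
  refine ext_of_forall_integral_eq_of_IsFiniteMeasure fun φ => ?_
  have h := (hasDensity_one x).continuous continuous_one continuous_const φ.continuous
  simp only [Pi.one_apply, mul_one] at h
  rw [integral_mul_const, integral_complex_ofReal, integral_complex_ofReal] at h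
  rw [integral_map hm.aemeasurable φ.continuous.aestronglyMeasurable, integral_smul_measure,
    ENNReal.toReal_ofReal (by positivity)]
  have h2 : ((∫ y, φ (dotS x y) ∂surf : ℝ) : ℂ) =
      ((2 * Real.pi * ∫ t in Ioo (-1 : ℝ) 1, φ t : ℝ) : ℂ) := by
    rw [h]; push_cast; ring
  simpa using (Complex.ofReal_injective h2)

lemma aestronglyMeasurable_comp_dotS (x : S2) {E : Type*} [TopologicalSpace E] {g : ℝ → E}
    (hg : AEStronglyMeasurable g (volume.restrict (Ioo (-1 : ℝ) 1))) :
    AEStronglyMeasurable (fun y => g (dotS x y)) surf :=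
  (hg.mono_ac Measure.smul_absolutelyContinuous).comp_measurePreserving
    (measurePreserving_dotS x)

lemma integrable_comp_dotS (x : S2) {E : Type*} [NormedAddCommGroup E] {g : ℝ → E}
    (hg : IntegrableOn g (Ioo (-1 : ℝ) 1)) : Integrable (fun y => g (dotS x y)) surf :=
  (measurePreserving_dotS x).integrable_comp_of_integrable
    (Integrable.smul_measure hg ENNReal.ofReal_ne_top)

lemma integral_comp_dotS (x : S2) {g : ℝ → ℝ}
    (hg : AEStronglyMeasurable g (volume.restrict (Ioo (-1 : ℝ) 1))) :
    ∫ y, g (dotS x y) ∂surf = 2 * Real.pi * ∫ t in Ioo (-1 : ℝ) 1, g t := by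
  have hm := measurePreserving_dotS x
  have h := integral_map hm.measurable.aemeasurable (f := g)
    (by rw [hm.map_eq]; exact hg.mono_ac Measure.smul_absolutelyContinuous)
  rw [← h, hm.map_eq, integral_smul_measure, ENNReal.toReal_ofReal (by positivity), smul_eq_mul]

/-- Densities represent integrals of integrable functions of `x · y`. -/
lemma HasDensity.integrable {x : S2} {h : S2 → ℂ} {K : ℝ → ℂ} (hd : HasDensity x h K)
    (hh : Continuous h) (hK : Continuous K) {g : ℝ → ℝ} (hg : IntegrableOn g (Ioo (-1 : ℝ) 1)) :
    ∫ y, (g (dotS x y) : ℂ) * h y ∂surf = ∫ t in Ioo (-1 : ℝ) 1, (g t : ℂ) * K t := by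
  obtain ⟨A, hA⟩ := (isCompact_range hh).isBounded.exists_norm_le
  obtain ⟨B, hB⟩ := (isCompact_Icc (a := (-1 : ℝ)) (b := 1)).exists_bound_of_continuousOn
    hK.continuousOn
  have hA' : ∀ y, ‖h y‖ ≤ A := fun y => hA _ ⟨y, rfl⟩
  have hA0 : 0 ≤ A := (norm_nonneg _).trans (hA' x)
  have hB0 : 0 ≤ B := (norm_nonneg _).trans (hB 0 (by norm_num))
  set M : ℝ := A * (2 * Real.pi) + B with hM
  have hM0 : 0 ≤ M := by positivity
  have is1 : ∀ u : ℝ → ℝ, IntegrableOn u (Ioo (-1 : ℝ) 1) →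
      Integrable (fun y => (u (dotS x y) : ℂ) * h y) surf := fun u hu =>
    (integrable_comp_dotS x hu).ofReal.mul_bdd hh.aestronglyMeasurable
      (Filter.Eventually.of_forall hA')
  have is2 : ∀ u : ℝ → ℝ, IntegrableOn u (Ioo (-1 : ℝ) 1) →
      IntegrableOn (fun t => (u t : ℂ) * K t) (Ioo (-1 : ℝ) 1) := fun u hu =>
    Integrable.mul_bdd (Integrable.ofReal hu) hK.aestronglyMeasurable
      ((ae_restrict_mem measurableSet_Ioo).mono fun t ht => hB t (Ioo_subset_Icc_self ht))
  have key : ∀ ε > 0, ‖(∫ y, (g (dotS x y) : ℂ) * h y ∂surf) -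
      ∫ t in Ioo (-1 : ℝ) 1, (g t : ℂ) * K t‖ ≤ ε * M := by
    intro ε hε
    -- Approximation in `L¹(-1, 1)` is also approximation in `L¹` of the sphere, by Archimedes'
    -- theorem and the bound on `h`.
    obtain ⟨φ, hφ, hφi⟩ := Integrable.exists_boundedContinuous_integral_sub_le hg hε
    have hp := hd.continuous hh hK φ.continuous
    have e1 : (∫ y, (g (dotS x y) : ℂ) * h y ∂surf) - ∫ y, (φ (dotS x y) : ℂ) * h y ∂surf =
        ∫ y, ((g (dotS x y) - φ (dotS x y) : ℝ) : ℂ) * h y ∂surf := by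
      rw [← integral_sub (is1 g hg) (is1 φ hφi)]
      simp [sub_mul]
    have e2 : (∫ t in Ioo (-1 : ℝ) 1, (g t : ℂ) * K t) - ∫ t in Ioo (-1 : ℝ) 1, (φ t : ℂ) * K t =
        ∫ t in Ioo (-1 : ℝ) 1, ((g t - φ t : ℝ) : ℂ) * K t := by
      rw [← integral_sub (is2 g hg) (is2 φ hφi)]
      simp [sub_mul]
    have hgφ : IntegrableOn (fun t => ‖g t - φ t‖) (Ioo (-1 : ℝ) 1) := (hg.sub hφi).norm
    have b1 : ‖∫ y, ((g (dotS x y) - φ (dotS x y) : ℝ) : ℂ) * h y ∂surf‖ ≤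
        A * (2 * Real.pi) * ε := by
      calc _ ≤ ∫ y, A * ‖g (dotS x y) - φ (dotS x y)‖ ∂surf := by
            refine norm_integral_le_of_norm_le ((integrable_comp_dotS x hgφ).const_mul A)
              (Filter.Eventually.of_forall fun y => ?_)
            rw [norm_mul, Complex.norm_real, mul_comm]
            gcongr
            exact hA' y
        _ = A * (2 * Real.pi) * ∫ t in Ioo (-1 : ℝ) 1, ‖g t - φ t‖ := by
            rw [integral_const_mul,
              integral_comp_dotS x (g := fun t => ‖g t - φ t‖) hgφ.aestronglyMeasurable]
            ring
        _ ≤ _ := by gcongr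
    have b2 : ‖∫ t in Ioo (-1 : ℝ) 1, ((g t - φ t : ℝ) : ℂ) * K t‖ ≤ B * ε := by
      calc _ ≤ ∫ t in Ioo (-1 : ℝ) 1, B * ‖g t - φ t‖ := by
            refine norm_integral_le_of_norm_le (hgφ.const_mul B)
              ((ae_restrict_mem measurableSet_Ioo).mono fun t ht => ?_)
            rw [norm_mul, Complex.norm_real, mul_comm]
            gcongr
            exact hB t (Ioo_subset_Icc_self ht)
        _ ≤ _ := by
            rw [integral_const_mul]
            gcongr
    calc _ = ‖(∫ y, ((g (dotS x y) - φ (dotS x y) : ℝ) : ℂ) * h y ∂surf) -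
          ∫ t in Ioo (-1 : ℝ) 1, ((g t - φ t : ℝ) : ℂ) * K t‖ := by
            rw [← e1, ← e2, hp]; congr 1; ring
      _ ≤ _ := (norm_sub_le _ _).trans (by rw [hM]; linarith)
  rw [← sub_eq_zero, ← norm_le_zero_iff]
  refine le_of_forall_pos_le_add fun δ hδ => ?_
  refine (key (δ / (M + 1)) (by positivity)).trans ?_
  rw [zero_add, div_mul_eq_mul_div, div_le_iff₀ (by positivity)]
  nlinarith

/-- Densities represent all absolutely convergent integrals. -/
theorem HasDensity.integral_eq {x : S2} {h : S2 → ℂ} {K : ℝ → ℂ} (hd : HasDensity x h K)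
    (hh : Continuous h) (hK : Continuous K) {g : ℝ → ℝ}
    (hg : AEStronglyMeasurable g (volume.restrict (Ioo (-1 : ℝ) 1)))
    (h1 : Integrable (fun y => (g (dotS x y) : ℂ) * h y) surf)
    (h2 : IntegrableOn (fun t => (g t : ℂ) * K t) (Ioo (-1 : ℝ) 1)) :
    ∫ y, (g (dotS x y) : ℂ) * h y ∂surf = ∫ t in Ioo (-1 : ℝ) 1, (g t : ℂ) * K t := by
  -- Here `g` need not be integrable, only its products with `h` and `K`. Truncating its values at
  -- height `n` gives bounded kernels, and these products dominate.
  let T : ℕ → ℝ → ℝ := fun n s => max (-(n : ℝ)) (min s n)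
  have hTc : ∀ n, Continuous (T n) := fun n => by fun_prop
  have hTb : ∀ n s, ‖T n s‖ ≤ n := fun n s => by
    rw [Real.norm_eq_abs, abs_le]
    exact ⟨le_max_left _ _, max_le (by linarith [n.cast_nonneg (α := ℝ)]) (min_le_right _ _)⟩
  have hTs : ∀ n s, ‖T n s‖ ≤ ‖s‖ := fun n s => by
    have hn := n.cast_nonneg (α := ℝ)
    rw [Real.norm_eq_abs, Real.norm_eq_abs, abs_le]
    constructor
    · exact le_max_of_le_right (le_min (neg_abs_le s) (by linarith [abs_nonneg s]))
    · exact max_le (by linarith [abs_nonneg s]) ((min_le_left _ _).trans (le_abs_self s))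
  have hTt : ∀ s, Filter.Tendsto (fun n => T n s) Filter.atTop (nhds s) := fun s => by
    refine tendsto_const_nhds.congr' ?_
    obtain ⟨N, hN⟩ := exists_nat_ge |s|
    filter_upwards [Filter.eventually_ge_atTop N] with n hn
    have hn' : |s| ≤ n := hN.trans (by exact_mod_cast hn)
    rw [abs_le] at hn'
    simp [T, min_eq_left hn'.2, max_eq_right hn'.1]
  have hTm : ∀ n, AEStronglyMeasurable (fun t => T n (g t)) (volume.restrict (Ioo (-1 : ℝ) 1)) :=
    fun n => (hTc n).comp_aestronglyMeasurable hg
  have hTi : ∀ n, IntegrableOn (fun t => T n (g t)) (Ioo (-1 : ℝ) 1) := fun n =>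
    (integrable_const (n : ℝ)).mono' (hTm n) (Filter.Eventually.of_forall fun t => hTb n _)
  have l1 : Filter.Tendsto (fun n => ∫ y, (T n (g (dotS x y)) : ℂ) * h y ∂surf) Filter.atTop
      (nhds (∫ y, (g (dotS x y) : ℂ) * h y ∂surf)) := by
    refine tendsto_integral_of_dominated_convergence (fun y => ‖(g (dotS x y) : ℂ) * h y‖)
      (fun n => ?_) h1.norm (fun n => Filter.Eventually.of_forall fun y => ?_)
      (Filter.Eventually.of_forall fun y => ?_)
    · exact (Complex.continuous_ofReal.comp_aestronglyMeasurable
        (aestronglyMeasurable_comp_dotS x (hTm n))).mul hh.aestronglyMeasurable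
    · rw [norm_mul, norm_mul, Complex.norm_real, Complex.norm_real]
      gcongr
      exact hTs n _
    · exact ((Complex.continuous_ofReal.tendsto _).comp (hTt _)).mul_const _
  have l2 : Filter.Tendsto (fun n => ∫ t in Ioo (-1 : ℝ) 1, (T n (g t) : ℂ) * K t) Filter.atTop
      (nhds (∫ t in Ioo (-1 : ℝ) 1, (g t : ℂ) * K t)) := by
    refine tendsto_integral_of_dominated_convergence (fun t => ‖(g t : ℂ) * K t‖)
      (fun n => ?_) h2.norm (fun n => Filter.Eventually.of_forall fun y => ?_)
      (Filter.Eventually.of_forall fun y => ?_)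
    · exact (Complex.continuous_ofReal.comp_aestronglyMeasurable (hTm n)).mul
        hK.aestronglyMeasurable
    · rw [norm_mul, norm_mul, Complex.norm_real, Complex.norm_real]
      gcongr
      exact hTs n _
    · exact ((Complex.continuous_ofReal.tendsto _).comp (hTt _)).mul_const _
  exact tendsto_nhds_unique l1 (l2.congr fun n => (hd.integrable hh hK (hTi n)).symm)

/-! ### Weak integration by parts on the interval -/

lemma exists_bound_deriv_smoothTransition :
    ∃ M : ℝ, 0 ≤ M ∧ ∀ s, |deriv Real.smoothTransition s| ≤ M := by
  have hc : Continuous (deriv Real.smoothTransition) :=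
    (Real.smoothTransition.contDiff (n := 1)).continuous_deriv le_rfl
  obtain ⟨M, hM⟩ := (isCompact_Icc (a := (0 : ℝ)) (b := 1)).exists_bound_of_continuousOn
    hc.continuousOn
  have hM0 : 0 ≤ M := (norm_nonneg _).trans (hM 0 (by norm_num))
  refine ⟨M, hM0, fun s => ?_⟩
  rcases lt_or_ge s 0 with hs | hs
  · have : Real.smoothTransition =ᶠ[nhds s] fun _ => 0 := by
      filter_upwards [Iio_mem_nhds hs] with r hr
      exact Real.smoothTransition.zero_of_nonpos hr.le
    rw [this.deriv_eq]
    simpa using hM0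
  rcases lt_or_ge 1 s with hs' | hs'
  · have : Real.smoothTransition =ᶠ[nhds s] fun _ => 1 := by
      filter_upwards [Ioi_mem_nhds hs'] with r hr
      exact Real.smoothTransition.one_of_one_le hr.le
    rw [this.deriv_eq]
    simpa using hM0
  · exact hM s ⟨hs, hs'⟩

lemma deriv_smoothTransition_of_one_lt {s : ℝ} (hs : 1 < s) :
    deriv Real.smoothTransition s = 0 := by
  have : Real.smoothTransition =ᶠ[nhds s] fun _ => 1 := by
    filter_upwards [Ioi_mem_nhds hs] with r hr
    exact Real.smoothTransition.one_of_one_le hr.le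
  rw [this.deriv_eq]
  simp

/-- A smooth cutoff function on the interval `(-1, 1)`. -/
def cutoff (n : ℕ) (t : ℝ) : ℝ := Real.smoothTransition (n * (1 - t ^ 2) - 1)

lemma contDiff_cutoff (n : ℕ) : ContDiff ℝ ∞ (cutoff n) := by
  unfold cutoff
  exact Real.smoothTransition.contDiff.comp (by fun_prop)

lemma cutoff_nonneg (n : ℕ) (t : ℝ) : 0 ≤ cutoff n t := Real.smoothTransition.nonneg _

lemma cutoff_le_one (n : ℕ) (t : ℝ) : cutoff n t ≤ 1 := Real.smoothTransition.le_one _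

lemma deriv_cutoff (n : ℕ) (t : ℝ) : deriv (cutoff n) t =
    deriv Real.smoothTransition (n * (1 - t ^ 2) - 1) * (-(2 * n * t)) := by
  have h1 : HasDerivAt (fun t : ℝ => n * (1 - t ^ 2) - 1) (-(2 * n * t)) t := by
    have := (((hasDerivAt_pow 2 t).const_sub 1).const_mul (n : ℝ)).sub_const 1
    refine this.congr_deriv ?_
    simp
    ring
  have h2 : HasDerivAt Real.smoothTransition (deriv Real.smoothTransition (n * (1 - t ^ 2) - 1))
      (n * (1 - t ^ 2) - 1) :=
    ((Real.smoothTransition.contDiff (n := 1)).differentiable one_ne_zero _).hasDerivAt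
  exact (h2.comp t h1).deriv

lemma tsupport_cutoff_subset (n : ℕ) : tsupport (cutoff n) ⊆ {t | 1 ≤ n * (1 - t ^ 2)} := by
  refine closure_minimal (fun t ht => ?_) (isClosed_le continuous_const (by fun_prop))
  by_contra h
  simp only [mem_ofPred_eq, not_le] at h
  exact ht (Real.smoothTransition.zero_of_nonpos (by linarith))

lemma tsupport_cutoff_subset_Ioo (n : ℕ) : tsupport (cutoff n) ⊆ Ioo (-1) 1 := by
  intro t ht
  have h := tsupport_cutoff_subset n ht
  simp only [mem_ofPred_eq] at h
  have hn : (0 : ℝ) ≤ n := n.cast_nonneg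
  have h2 : 0 < 1 - t ^ 2 := by
    by_contra h3
    nlinarith
  exact abs_lt.mp (by rw [← sq_lt_one_iff_abs_lt_one]; linarith)

lemma eventually_lt_cutoff_arg {t : ℝ} (ht : t ∈ Ioo (-1 : ℝ) 1) :
    ∀ᶠ n : ℕ in Filter.atTop, 1 < n * (1 - t ^ 2) - 1 := by
  have h : 0 < 1 - t ^ 2 := by nlinarith [ht.1, ht.2]
  have := (tendsto_natCast_atTop_atTop (R := ℝ)).atTop_mul_const h
  filter_upwards [this.eventually_gt_atTop 2] with n hn
  linarith

/-- Where the derivative is non-zero, `n (1 - t²) ≤ 2`; its size is at most `2nM`, so the bound is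
uniform in `n`. The factor `1 - t²` of the test polynomial thus compensates the steep cutoff. -/
lemma abs_deriv_cutoff_mul_le {M : ℝ} (hM : ∀ s, |deriv Real.smoothTransition s| ≤ M) (n : ℕ)
    {t : ℝ} (ht : t ∈ Ioo (-1 : ℝ) 1) : |deriv (cutoff n) t| * (1 - t ^ 2) ≤ 4 * M := by
  have h : 0 < 1 - t ^ 2 := by nlinarith [ht.1, ht.2]
  have hM0 : 0 ≤ M := (abs_nonneg _).trans (hM 0)
  rw [deriv_cutoff, abs_mul]
  rcases lt_or_ge 1 (n * (1 - t ^ 2) - 1) with h1 | h1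
  · rw [deriv_smoothTransition_of_one_lt h1]
    simpa using hM0
  · have h2 : |(-(2 * n * t))| ≤ 2 * n := by
      rw [abs_neg, abs_mul, abs_of_nonneg (by positivity : (0 : ℝ) ≤ 2 * n)]
      have : |t| ≤ 1 := (abs_lt.mpr ht).le
      exact mul_le_of_le_one_right (by positivity) this
    calc _ ≤ M * (2 * n) * (1 - t ^ 2) := by gcongr; exact hM _
      _ ≤ 4 * M := by nlinarith

lemma one_sub_sq_le_sqrt {t : ℝ} (ht : t ∈ Ioo (-1 : ℝ) 1) : 1 - t ^ 2 ≤ Real.sqrt (1 - t ^ 2) := by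
  have h : 0 < 1 - t ^ 2 := by nlinarith [ht.1, ht.2]
  apply Real.le_sqrt_of_sq_le
  nlinarith [sq_nonneg t]

/-- Integration by parts against polynomials vanishing at the end points. -/
theorem IsWeakDeriv.integral_mul_polynomial {f f' : ℝ → ℝ} (hf : IntegrableOn f (Ioo (-1 : ℝ) 1))
    (hderiv : IsWeakDeriv f f')
    (hf' : IntegrableOn (fun t => Real.sqrt (1 - t ^ 2) * f' t) (Ioo (-1 : ℝ) 1))
    (S : Polynomial ℝ) :
    ∫ t in Ioo (-1 : ℝ) 1, f t * (Polynomial.derivative ((1 - Polynomial.X ^ 2) * S)).eval t =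
      -∫ t in Ioo (-1 : ℝ) 1, f' t * ((1 - Polynomial.X ^ 2) * S).eval t := by
  set R := (1 - Polynomial.X ^ 2) * S with hR
  have hRe : ∀ t, R.eval t = (1 - t ^ 2) * S.eval t := fun t => by simp [hR]
  obtain ⟨M, hM0, hM⟩ := exists_bound_deriv_smoothTransition
  obtain ⟨C, hC⟩ := (isCompact_Icc (a := (-1 : ℝ)) (b := 1)).exists_bound_of_continuousOn
    S.continuous.continuousOn
  obtain ⟨D, hD⟩ := (isCompact_Icc (a := (-1 : ℝ)) (b := 1)).exists_bound_of_continuousOn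
    (Polynomial.derivative R).continuous.continuousOn
  have hfm : AEStronglyMeasurable f' (volume.restrict (Ioo (-1 : ℝ) 1)) :=
    hderiv.2.1.aestronglyMeasurable
  have hcd : ∀ n, ContDiff ℝ ∞ (fun t => cutoff n t * R.eval t) := fun n =>
    (contDiff_cutoff n).mul (by simpa using R.contDiff_aeval (𝕜 := ℝ) ∞)
  have hsupp : ∀ n, tsupport (fun t => cutoff n t * R.eval t) ⊆ tsupport (cutoff n) := fun n =>
    tsupport_mul_subset_left
  have hcomp : ∀ n, HasCompactSupport (fun t => cutoff n t * R.eval t) := fun n => by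
    refine HasCompactSupport.mul_right ?_
    refine isCompact_Icc.of_isClosed_subset (isClosed_tsupport _)
      ((tsupport_cutoff_subset_Ioo n).trans Ioo_subset_Icc_self)
  have hd : ∀ n t, deriv (fun t => cutoff n t * R.eval t) t =
      deriv (cutoff n) t * R.eval t + cutoff n t * (Polynomial.derivative R).eval t := fun n t =>
    ((((contDiff_cutoff n).differentiable (by simp)) t).hasDerivAt.mul (R.hasDerivAt t)).deriv
  have hparts := fun n => hderiv.2.2 _ (hcd n) (hcomp n)
    ((hsupp n).trans (tsupport_cutoff_subset_Ioo n))
  -- At a fixed interior point the cutoff is locally `1` for large `n`, so its derivative disappears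
  -- from the limit.
  have l1 : Filter.Tendsto (fun n => ∫ t in Ioo (-1 : ℝ) 1,
      f t * deriv (fun t => cutoff n t * R.eval t) t) Filter.atTop
      (nhds (∫ t in Ioo (-1 : ℝ) 1, f t * (Polynomial.derivative R).eval t)) := by
    refine tendsto_integral_of_dominated_convergence (fun t => ‖f t‖ * (4 * M * C + D))
      (fun n => ?_) (hf.norm.mul_const _) (fun n => ?_) ?_
    · exact hf.aestronglyMeasurable.mul
        ((hcd n).continuous_deriv (by simp)).aestronglyMeasurable
    · refine (ae_restrict_mem measurableSet_Ioo).mono fun t ht => ?_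
      have ht' := Ioo_subset_Icc_self ht
      rw [norm_mul, hd]
      refine mul_le_mul_of_nonneg_left ((norm_add_le _ _).trans (add_le_add ?_ ?_)) (norm_nonneg _)
      · have h : 0 < 1 - t ^ 2 := by nlinarith [ht.1, ht.2]
        rw [hRe, norm_mul, norm_mul, ← mul_assoc, Real.norm_eq_abs, Real.norm_eq_abs,
          abs_of_pos h]
        exact mul_le_mul (abs_deriv_cutoff_mul_le hM n ht) (hC t ht') (norm_nonneg _) (by positivity)
      · rw [norm_mul, Real.norm_eq_abs, abs_of_nonneg (cutoff_nonneg _ _)]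
        exact (mul_le_of_le_one_left (norm_nonneg _) (cutoff_le_one _ _)).trans (hD t ht')
    · refine (ae_restrict_mem measurableSet_Ioo).mono fun t ht => ?_
      refine tendsto_const_nhds.congr' ?_
      filter_upwards [eventually_lt_cutoff_arg ht] with n hn
      rw [hd, deriv_cutoff, deriv_smoothTransition_of_one_lt hn, cutoff,
        Real.smoothTransition.one_of_one_le hn.le]
      ring
  -- The domination uses `1 - t² ≤ √(1 - t²)` on the interval.
  have l2 : Filter.Tendsto (fun n => ∫ t in Ioo (-1 : ℝ) 1, f' t * (cutoff n t * R.eval t))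
      Filter.atTop (nhds (∫ t in Ioo (-1 : ℝ) 1, f' t * R.eval t)) := by
    refine tendsto_integral_of_dominated_convergence
      (fun t => ‖Real.sqrt (1 - t ^ 2) * f' t‖ * C)
      (fun n => ?_) (hf'.norm.mul_const _) (fun n => ?_) ?_
    · exact hfm.mul (hcd n).continuous.aestronglyMeasurable
    · refine (ae_restrict_mem measurableSet_Ioo).mono fun t ht => ?_
      have ht' := Ioo_subset_Icc_self ht
      have h : 0 < 1 - t ^ 2 := by nlinarith [ht.1, ht.2]
      have hs := one_sub_sq_le_sqrt ht
      have hc := cutoff_le_one n t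
      have hc0 := cutoff_nonneg n t
      have hC' := hC t ht'
      have hC0 : 0 ≤ C := (norm_nonneg _).trans hC'
      rw [hRe, norm_mul, norm_mul, norm_mul, norm_mul, Real.norm_of_nonneg hc0,
        Real.norm_of_nonneg h.le, Real.norm_of_nonneg (Real.sqrt_nonneg _)]
      calc _ ≤ ‖f' t‖ * (1 * (Real.sqrt (1 - t ^ 2) * C)) := by gcongr
        _ = _ := by ring
    · refine (ae_restrict_mem measurableSet_Ioo).mono fun t ht => ?_
      refine tendsto_const_nhds.congr' ?_
      filter_upwards [eventually_lt_cutoff_arg ht] with n hn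
      rw [cutoff, Real.smoothTransition.one_of_one_le hn.le, one_mul]
  refine tendsto_nhds_unique l1 (l2.neg.congr fun n => ?_)
  exact (hparts n).symm

/-! ### The two scalar localization integrals -/

open Polynomial in
/-- The polynomial factor of the primitive of `-P_ℓ` vanishing at the end points, for `1 ≤ ℓ`. -/
def legendrePrim (ℓ : ℕ) : Polynomial ℝ :=
  C (1 / ((ℓ : ℝ) * (ℓ + 1))) * derivative (legendrePoly ℓ)

-- Legendre's equation in divergence form, `((1 - t²) P_ℓ')' = -ℓ(ℓ+1) P_ℓ`.
open Polynomial in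
lemma derivative_legendrePrim {ℓ : ℕ} (hℓ : ℓ ≠ 0) :
    derivative ((1 - X ^ 2) * legendrePrim ℓ) = -legendrePoly ℓ := by
  have ho := legendrePoly_ode ℓ
  have hc : C (1 / ((ℓ : ℝ) * (ℓ + 1))) * ((ℓ : ℝ[X]) * ((ℓ : ℝ[X]) + 1)) = 1 := by
    rw [← Polynomial.C_eq_natCast, ← C_1, ← C_add, ← C_mul, ← C_mul]
    congr 1
    have : (ℓ : ℝ) ≠ 0 := by exact_mod_cast hℓ
    field_simp
  have h2 : derivative (2 : ℝ[X]) = 0 := derivative_ofNat 2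
  simp only [legendrePrim, derivative_mul, derivative_sub, derivative_one, derivative_C,
    derivative_X_pow, Nat.cast_ofNat, map_ofNat]
  linear_combination C (1 / ((ℓ : ℝ) * (ℓ + 1))) * ho - legendrePoly ℓ * hc

/-- By the density at `n = 0`, the mean integral of `ang i p` is `4π` times its value at `x`; but
infinitesimal rotations have mean zero. -/
lemma IsEigen.pval_ang_eq_zero {p : MvPolynomial (Fin 3) ℂ} (hp : IsEigen 0 p) (i : Fin 3)
    (x : S2) : pval (SphereCalc.ang i p) x = 0 := by
  have h := (hp.ang i).hasDensity x 0
  simp only [pow_zero, one_mul, integral_pval_ang, legendreP_zero] at h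
  have : (Real.pi : ℂ) ≠ 0 := by exact_mod_cast Real.pi_ne_zero
  simpa [this] using h.symm

open Polynomial in
/-- The density of the tangential components of the localization integrals. -/
lemma IsEigen.hasDensity_cross {ℓ : ℕ} {p : MvPolynomial (Fin 3) ℂ} (hp : IsEigen ℓ p) (i : Fin 3)
    (x : S2) : HasDensity x (fun y => (crossS i x y : ℂ) * pval p y)
      (fun t => 2 * Real.pi * pval (SphereCalc.ang i p) x *
        ((((1 - X ^ 2) * legendrePrim ℓ).eval t : ℝ) : ℂ)) := by
  intro n
  have hn : ((n : ℂ) + 1) ≠ 0 := by exact_mod_cast n.succ_ne_zero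
  -- The power `n + 1` is chosen because `ang i` lowers it to `(x·y)^n` and produces the factor `(x
  -- × y)_i`.
  have h1 := integral_pval_mul_ang i (dotPoly x ^ (n + 1)) p
  have h2 := (hp.ang i).hasDensity x (n + 1)
  simp only [pval_pow, pval_dotPoly] at h1
  rw [h2] at h1
  have e1 : ∀ y : S2, pval (SphereCalc.ang i (dotPoly x ^ (n + 1))) y * pval p y =
      -(n + 1) * ((dotS x y : ℂ) ^ n * ((crossS i x y : ℂ) * pval p y)) := by
    intro y
    rw [Derivation.leibniz_pow]
    simp [pval_dotPoly, pval_ang_dotPoly]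
    ring
  simp only [e1] at h1
  rw [integral_const_mul] at h1
  simp only [mul_left_comm _ (2 * Real.pi * pval (SphereCalc.ang i p) x : ℂ)] at h1 ⊢
  rw [integral_const_mul] at h1 ⊢
  -- `P_0` has no primitive vanishing at both end points, so `ℓ = 0` is separate: there `ang i p`
  -- vanishes on the sphere.
  rcases eq_or_ne ℓ 0 with rfl | hℓ
  · rw [hp.pval_ang_eq_zero] at h1 ⊢
    rw [mul_zero, zero_mul] at h1 ⊢
    have h3 : ((n : ℂ) + 1) * ∫ y : S2, (dotS x y : ℂ) ^ n * ((crossS i x y : ℂ) * pval p y) ∂surf = 0 := by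
      linear_combination -h1
    exact (mul_eq_zero.mp h3).resolve_left hn
  · have h3 := integral_eval_derivative (X ^ (n + 1) * ((1 - X ^ 2) * legendrePrim ℓ)) (-1) 1
    rw [← integral_Ioo_eq] at h3
    have e2 : ∀ t : ℝ, (derivative (X ^ (n + 1) * ((1 - X ^ 2) * legendrePrim ℓ))).eval t =
        (n + 1) * (t ^ n * ((1 - X ^ 2) * legendrePrim ℓ).eval t) -
          t ^ (n + 1) * legendreP ℓ t := by
      intro t
      rw [derivative_mul, derivative_legendrePrim hℓ, ← eval_legendrePoly]
      simp
      ring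
    simp only [e2] at h3
    have hP := continuous_legendreP ℓ
    rw [integral_sub (Continuous.integrableOn_Ioo (by fun_prop) _ _)
      (Continuous.integrableOn_Ioo (by fun_prop) _ _), integral_const_mul] at h3
    have h4 := congrArg Complex.ofReal h3
    simp only [Complex.ofReal_sub, Complex.ofReal_mul, ← integral_complex_ofReal] at h4
    push_cast [eval_mul, eval_sub, eval_pow, eval_X, eval_one] at h1 h4 ⊢
    apply mul_left_cancel₀ hn
    linear_combination -h1 - (2 * Real.pi * pval (SphereCalc.ang i p) x : ℂ) * h4

/-- The function `F` on the sphere is integrable with integral `v`. -/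
def HasInt (F : S2 → ℂ) (v : ℂ) : Prop := Integrable F surf ∧ ∫ y, F y ∂surf = v

lemma HasInt.add {F G : S2 → ℂ} {v w : ℂ} (hF : HasInt F v) (hG : HasInt G w) :
    HasInt (fun y => F y + G y) (v + w) :=
  ⟨hF.1.add hG.1, by rw [integral_add hF.1 hG.1, hF.2, hG.2]⟩

lemma HasInt.const_mul {F : S2 → ℂ} {v : ℂ} (hF : HasInt F v) (a : ℂ) :
    HasInt (fun y => a * F y) (a * v) :=
  ⟨hF.1.const_mul a, by rw [integral_const_mul, hF.2]⟩

lemma ofReal_lam (ℓ : ℕ) (g : ℝ → ℝ) :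
    (lam ℓ g : ℂ) = 2 * Real.pi * ∫ t in Ioo (-1 : ℝ) 1, (g t : ℂ) * (legendreP ℓ t : ℂ) := by
  rw [lam, Complex.ofReal_mul, ← integral_complex_ofReal]
  push_cast
  simp only [mul_comm]

/-- The Funk–Hecke formula. -/
theorem IsEigen.funkHecke {ℓ : ℕ} {p : MvPolynomial (Fin 3) ℂ} (hp : IsEigen ℓ p) (x : S2)
    {g : ℝ → ℝ} (hg : IntegrableOn g (Ioo (-1 : ℝ) 1)) :
    HasInt (fun y => (g (dotS x y) : ℂ) * pval p y) (lam ℓ g * pval p x) := by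
  have hP := continuous_legendreP ℓ
  obtain ⟨A, hA⟩ := (isCompact_range (continuous_pval_sphere p)).isBounded.exists_norm_le
  refine ⟨(integrable_comp_dotS x hg).ofReal.mul_bdd
    (continuous_pval_sphere p).aestronglyMeasurable
    (Filter.Eventually.of_forall fun y => hA _ ⟨y, rfl⟩), ?_⟩
  rw [(hp.hasDensity x).integrable (continuous_pval_sphere p) (by fun_prop) hg, ofReal_lam]
  simp only [mul_left_comm _ (2 * Real.pi * pval p x : ℂ)]
  rw [integral_const_mul]
  ring

/-- The density is identically zero when `p` vanishes at `x`, so integrability over the sphere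
suffices and `g` itself need not be integrable. -/
lemma IsEigen.funkHecke_of_zero {ℓ : ℕ} {p : MvPolynomial (Fin 3) ℂ} (hp : IsEigen ℓ p) {x : S2}
    (hx : pval p x = 0) {g : ℝ → ℝ} (hg : AEStronglyMeasurable g (volume.restrict (Ioo (-1 : ℝ) 1)))
    (hi : Integrable (fun y => (g (dotS x y) : ℂ) * pval p y) surf) :
    HasInt (fun y => (g (dotS x y) : ℂ) * pval p y) 0 := by
  have hP := continuous_legendreP ℓ
  refine ⟨hi, ?_⟩
  rw [(hp.hasDensity x).integral_eq (continuous_pval_sphere p) (by fun_prop) hg hi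
    (by simp [hx])]
  simp [hx]

lemma integrable_cross {f' : ℝ → ℝ}
    (hm : AEStronglyMeasurable f' (volume.restrict (Ioo (-1 : ℝ) 1)))
    (hf' : IntegrableOn (fun t => Real.sqrt (1 - t ^ 2) * f' t) (Ioo (-1 : ℝ) 1))
    (i : Fin 3) (x : S2) {h : S2 → ℂ} (hh : Continuous h) :
    Integrable (fun y => (f' (dotS x y) : ℂ) * ((crossS i x y : ℂ) * h y)) surf := by
  obtain ⟨A, hA⟩ := (isCompact_range hh).isBounded.exists_norm_le
  have hc : Continuous (fun y => crossS i x y) := by unfold crossS; fun_prop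
  refine ((integrable_comp_dotS x hf'.norm).mul_const A).mono'
    ((Complex.continuous_ofReal.comp_aestronglyMeasurable
      (aestronglyMeasurable_comp_dotS x hm)).mul
      (Continuous.aestronglyMeasurable (by fun_prop))) (Filter.Eventually.of_forall fun y => ?_)
  have h1 := abs_crossS_le i x y
  have h2 := hA _ ⟨y, rfl⟩
  rw [norm_mul, norm_mul, Complex.norm_real, Complex.norm_real, norm_mul, Real.norm_eq_abs,
    Real.norm_eq_abs, Real.norm_of_nonneg (Real.sqrt_nonneg _)]
  calc _ ≤ |f' (dotS x y)| * (Real.sqrt (1 - dotS x y ^ 2) * A) := by gcongr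
    _ = _ := by ring

open Polynomial in
/-- The localization formula for the tangential components. -/
theorem IsEigen.hasInt_cross {ℓ : ℕ} {p : MvPolynomial (Fin 3) ℂ} (hp : IsEigen ℓ p)
    {f f' : ℝ → ℝ} (hf : IntegrableOn f (Ioo (-1 : ℝ) 1)) (hderiv : IsWeakDeriv f f')
    (hf' : IntegrableOn (fun t => Real.sqrt (1 - t ^ 2) * f' t) (Ioo (-1 : ℝ) 1))
    (i : Fin 3) (x : S2) :
    HasInt (fun y => (f' (dotS x y) : ℂ) * ((crossS i x y : ℂ) * pval p y))
      (lam ℓ f * pval (SphereCalc.ang i p) x) := by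
  have hm : AEStronglyMeasurable f' (volume.restrict (Ioo (-1 : ℝ) 1)) :=
    hderiv.2.1.aestronglyMeasurable
  have hi := integrable_cross hm hf' i x (continuous_pval_sphere p)
  refine ⟨hi, ?_⟩
  have hc : Continuous (fun y => crossS i x y) := by unfold crossS; fun_prop
  have hpc := continuous_pval_sphere p
  set R := (1 - X ^ 2) * legendrePrim ℓ with hR
  have hRc := R.continuous
  have hi2 : IntegrableOn (fun t => f' t * R.eval t) (Ioo (-1 : ℝ) 1) := by
    obtain ⟨C, hC⟩ := (isCompact_Icc (a := (-1 : ℝ)) (b := 1)).exists_bound_of_continuousOn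
      (legendrePrim ℓ).continuous.continuousOn
    refine (hf'.norm.mul_const C).mono' (hm.mul hRc.aestronglyMeasurable)
      ((ae_restrict_mem measurableSet_Ioo).mono fun t ht => ?_)
    have h : 0 < 1 - t ^ 2 := by nlinarith [ht.1, ht.2]
    have hs := one_sub_sq_le_sqrt ht
    have hC' := hC t (Ioo_subset_Icc_self ht)
    simp only [hR, eval_mul, eval_sub, eval_one, eval_pow, eval_X]
    rw [norm_mul, norm_mul, norm_mul, Real.norm_of_nonneg h.le,
      Real.norm_of_nonneg (Real.sqrt_nonneg _)]
    calc _ ≤ ‖f' t‖ * (Real.sqrt (1 - t ^ 2) * C) := by gcongr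
      _ = _ := by ring
  have hi3 : IntegrableOn (fun t => (f' t : ℂ) *
      (2 * Real.pi * pval (SphereCalc.ang i p) x * ((R.eval t : ℝ) : ℂ))) (Ioo (-1 : ℝ) 1) := by
    refine ((Integrable.ofReal (𝕜 := ℂ) hi2).const_mul
      (2 * Real.pi * pval (SphereCalc.ang i p) x)).congr (Filter.Eventually.of_forall fun t => ?_)
    simp
    ring
  rw [(hp.hasDensity_cross i x).integral_eq (by fun_prop) (by fun_prop) hm hi hi3]
  rcases eq_or_ne ℓ 0 with rfl | hℓ
  · simp [hp.pval_ang_eq_zero]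
  have hw := hderiv.integral_mul_polynomial hf hf' (legendrePrim ℓ)
  rw [derivative_legendrePrim hℓ] at hw
  simp only [eval_neg, eval_legendrePoly, mul_neg, integral_neg, neg_inj] at hw
  have hw' := congrArg Complex.ofReal hw
  rw [← integral_complex_ofReal, ← integral_complex_ofReal] at hw'
  push_cast at hw'
  rw [ofReal_lam, hw']
  simp only [mul_left_comm _ (2 * Real.pi * pval (SphereCalc.ang i p) x : ℂ)]
  rw [integral_const_mul]
  ring

/-! ### Surface gradient and Laplacian of polynomials -/

open MvPolynomial in
/-- The tangential part of the `i`-th partial derivative on the sphere. -/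
def tang (i : Fin 3) (p : MvPolynomial (Fin 3) ℂ) : MvPolynomial (Fin 3) ℂ :=
  pderiv i p - X i * ∑ j, X j * pderiv j p

/-- The extension of a polynomial function on the sphere that is constant along rays. -/
def rayExt (p : MvPolynomial (Fin 3) ℂ) (v : E3) : ℂ := pval p (‖v‖⁻¹ • v)

lemma radialExt_eventuallyEq (p : MvPolynomial (Fin 3) ℂ) {v : E3} (hv : v ≠ 0) :
    radialExt (fun y => pval p y) =ᶠ[nhds v] rayExt p := by
  filter_upwards [isOpen_ne.mem_nhds hv] with w hw
  simp only [radialExt, rayExt, dif_neg hw]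

lemma hasFDerivAt_norm_inv {v : E3} (hv : v ≠ 0) :
    HasFDerivAt (fun w : E3 => ‖w‖⁻¹) (-(‖v‖⁻¹ ^ 3) • innerSL ℝ v) v := by
  have hn : ‖v‖ ≠ 0 := norm_ne_zero_iff.mpr hv
  have h1 : HasFDerivAt (fun w : E3 => ‖w‖ ^ 2) (2 • innerSL ℝ v) v :=
    (hasStrictFDerivAt_norm_sq v).hasFDerivAt
  have h2 := (h1.sqrt (pow_ne_zero 2 hn))
  have h3 := (hasDerivAt_inv (x := Real.sqrt (‖v‖ ^ 2))
    (by rwa [Real.sqrt_sq (norm_nonneg _)])).comp_hasFDerivAt v h2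
  have e : (fun w : E3 => ‖w‖⁻¹) = (fun y => y⁻¹) ∘ fun w : E3 => Real.sqrt (‖w‖ ^ 2) := by
    ext w
    simp
  rw [e]
  refine h3.congr_fderiv ?_
  ext w
  simp only [Real.sqrt_sq (norm_nonneg v), smul_apply, smul_eq_mul,
    nsmul_eq_mul, innerSL_apply_apply]
  field_simp
  simp

lemma hasFDerivAt_normalize {v : E3} (hv : v ≠ 0) :
    HasFDerivAt (fun w : E3 => ‖w‖⁻¹ • w)
      (‖v‖⁻¹ • ContinuousLinearMap.id ℝ E3 + (-(‖v‖⁻¹ ^ 3) • innerSL ℝ v).smulRight v) v :=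
  (hasFDerivAt_norm_inv hv).smul (hasFDerivAt_id v)

lemma contDiffAt_rayExt (p : MvPolynomial (Fin 3) ℂ) {v : E3} (hv : v ≠ 0) {n : WithTop ℕ∞} :
    ContDiffAt ℝ n (rayExt p) v :=
  (contDiff_pval p).contDiffAt.comp v
    (((contDiffAt_norm ℝ hv).inv (norm_ne_zero_iff.mpr hv)).smul contDiffAt_id)

/-- A function constant along rays has derivatives homogeneous of degree `-1`. Stating this off the
sphere allows a second differentiation. -/
lemma fderiv_rayExt (p : MvPolynomial (Fin 3) ℂ) {v : E3} (hv : v ≠ 0) (i : Fin 3) :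
    fderiv ℝ (rayExt p) v (EuclideanSpace.single i (1 : ℝ)) =
      ((‖v‖⁻¹ : ℝ) : ℂ) * rayExt (tang i p) v := by
  have hn : (‖v‖ : ℂ) ≠ 0 := by exact_mod_cast norm_ne_zero_iff.mpr hv
  have h := HasFDerivAt.comp (f := fun w : E3 => ‖w‖⁻¹ • w) v (hasFDerivAt_pval p (‖v‖⁻¹ • v))
    (hasFDerivAt_normalize hv)
  have h' : fderiv ℝ (rayExt p) v = _ := h.fderiv
  rw [h']
  fin_cases i <;>
    simp [Fin.sum_univ_three, coordC_apply, rayExt, tang, EuclideanSpace.inner_single_right] <;>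
    field_simp <;> ring

lemma sphere_ne_zero (x : S2) : (x : E3) ≠ 0 := by
  intro h
  have : ‖(x : E3)‖ = 1 := by simp
  rw [h, norm_zero] at this
  exact zero_ne_one this

lemma rayExt_sphere (p : MvPolynomial (Fin 3) ℂ) (x : S2) : rayExt p x = pval p x := by
  simp [rayExt]

lemma surfGrad_pval (p : MvPolynomial (Fin 3) ℂ) (x : S2) (i : Fin 3) :
    surfGrad (fun y => pval p y) x i = pval (tang i p) x := by
  rw [surfGrad, (radialExt_eventuallyEq p (sphere_ne_zero x)).fderiv_eq,
    fderiv_rayExt p (sphere_ne_zero x), rayExt_sphere]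
  simp

lemma fderiv_fderiv_rayExt (p : MvPolynomial (Fin 3) ℂ) (x : S2) (i : Fin 3) :
    fderiv ℝ (fderiv ℝ (rayExt p)) (x : E3) (EuclideanSpace.single i (1 : ℝ))
      (EuclideanSpace.single i (1 : ℝ)) =
      pval (tang i (tang i p)) x - ((x : E3) i : ℂ) * pval (tang i p) x := by
  have hx := sphere_ne_zero x
  have hd : DifferentiableAt ℝ (fderiv ℝ (rayExt p)) (x : E3) :=
    ((contDiffAt_rayExt p hx (n := 2)).fderiv_right (m := 1) (by norm_num)).differentiableAt
      one_ne_zero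
  have e : (fun v => fderiv ℝ (rayExt p) v (EuclideanSpace.single i (1 : ℝ))) =ᶠ[nhds (x : E3)]
      fun v => ((‖v‖⁻¹ : ℝ) : ℂ) * rayExt (tang i p) v := by
    filter_upwards [isOpen_ne.mem_nhds hx] with v hv
    exact fderiv_rayExt p hv i
  have h1 := (hd.hasFDerivAt.clm_apply (hasFDerivAt_const (EuclideanSpace.single i (1 : ℝ)) (x : E3))).fderiv
  rw [e.fderiv_eq] at h1
  have h2 : HasFDerivAt (fun v : E3 => ((‖v‖⁻¹ : ℝ) : ℂ)) _ (x : E3) :=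
    Complex.ofRealCLM.hasFDerivAt.comp (x : E3) (hasFDerivAt_norm_inv hx)
  have h3 := (h2.mul ((contDiffAt_rayExt (tang i p) hx (n := 1)).differentiableAt
    one_ne_zero).hasFDerivAt).fderiv
  have h4 := congrArg (fun L => L (EuclideanSpace.single i (1 : ℝ))) (h1.symm.trans h3)
  simp [fderiv_rayExt _ hx, rayExt_sphere, EuclideanSpace.inner_single_right] at h4
  rw [h4]
  ring

lemma surfLaplacian_pval (p : MvPolynomial (Fin 3) ℂ) (x : S2) :
    surfLaplacian (fun y => pval p y) x = pval (angSq p) x := by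
  have hx := sphere_ne_zero x
  have hr := sphere_sq_complex x
  have h01 := pderiv_pderiv_comm 0 1 p
  have h02 := pderiv_pderiv_comm 0 2 p
  have h12 := pderiv_pderiv_comm 1 2 p
  rw [surfLaplacian, Filter.EventuallyEq.eq_of_nhds
    (InnerProductSpace.laplacian_congr_nhds (radialExt_eventuallyEq p hx)),
    congrFun (InnerProductSpace.laplacian_eq_iteratedFDeriv_orthonormalBasis (rayExt p)
      (EuclideanSpace.basisFun (Fin 3) ℝ)) (x : E3)]
  simp only [iteratedFDeriv_two_apply, EuclideanSpace.basisFun_apply, Matrix.cons_val_zero,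
    Matrix.cons_val_one, fderiv_fderiv_rayExt]
  simp [Fin.sum_univ_three, tang, angSq, ang_apply, Fin.reduceAdd, MvPolynomial.pderiv_X, h01, h02, h12]
  generalize (((x : E3) 0 : ℝ) : ℂ) = a at *
  generalize (((x : E3) 1 : ℝ) : ℂ) = b at *
  generalize (((x : E3) 2 : ℝ) : ℂ) = c at *
  generalize pval (MvPolynomial.pderiv 0 p) x = p0
  generalize pval (MvPolynomial.pderiv 1 p) x = p1
  generalize pval (MvPolynomial.pderiv 2 p) x = p2
  generalize pval (MvPolynomial.pderiv 0 (MvPolynomial.pderiv 0 p)) x = p00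
  generalize pval (MvPolynomial.pderiv 1 (MvPolynomial.pderiv 1 p)) x = p11
  generalize pval (MvPolynomial.pderiv 2 (MvPolynomial.pderiv 2 p)) x = p22
  generalize pval (MvPolynomial.pderiv 1 (MvPolynomial.pderiv 0 p)) x = p01
  generalize pval (MvPolynomial.pderiv 2 (MvPolynomial.pderiv 0 p)) x = p02
  generalize pval (MvPolynomial.pderiv 2 (MvPolynomial.pderiv 1 p)) x = p12
  -- The two expressions agree only modulo `|x|² = 1`; this is the cofactor.
  linear_combination (-(p00 + p11 + p22) + 3 * (a * p0 + b * p1 + c * p2) +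
    (a ^ 2 * p00 + b ^ 2 * p11 + c ^ 2 * p22 + 2 * a * b * p01 + 2 * a * c * p02 +
      2 * b * c * p12)) * hr

/-! ### Spherical harmonics as polynomial eigenfunctions -/

open Polynomial in
/-- The symmetry of Rodrigues' formula between the orders `k` and `-k`. -/
lemma exists_rodrigues_symm (ℓ k : ℕ) (hk : k ≤ ℓ) :
    ∃ c : ℝ, rodrigues ℓ (ℓ - k) = C c * (1 - X ^ 2) ^ k * rodrigues ℓ (ℓ + k) := by
  induction k with
  | zero => exact ⟨1, by simp⟩
  | succ k ih =>
    obtain ⟨c, hc⟩ := ih (by omega)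
    obtain ⟨n, rfl⟩ : ∃ n, ℓ = n + k + 1 := ⟨ℓ - k - 1, by omega⟩
    have e1 : n + k + 1 - k = n + 1 := by omega
    have e2 : n + k + 1 - (k + 1) = n := by omega
    rw [e1] at hc
    rw [e2]
    have ho := rodrigues_ode (n + k + 1) n
    have hd := congrArg derivative hc
    have hp : (1 - X ^ 2) * derivative ((1 - X ^ 2 : ℝ[X]) ^ k) =
        -(2 * (k : ℝ[X]) * X * (1 - X ^ 2) ^ k) := by
      rcases k with _ | k
      · simp
      · rw [derivative_pow]
        simp
        ring
    rw [derivative_rodrigues, mul_assoc, derivative_C_mul, derivative_mul, derivative_rodrigues]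
      at hd
    -- The coefficient of the undifferentiated term in Rodrigues' equation, non-zero because `n <
    -- 2ℓ`. Dividing by it expresses the lower derivative through the two higher ones, which the
    -- induction hypothesis and its derivative supply.
    set a : ℝ := ((n : ℝ) + 1) * (2 * ((n + k + 1 : ℕ) : ℝ) - n) with ha
    have ha0 : a ≠ 0 := by
      rw [ha]
      push_cast
      have : (0 : ℝ) < ((n : ℝ) + 1) * (2 * ((n : ℝ) + k + 1) - n) := by
        have : (0 : ℝ) < 2 * ((n : ℝ) + k + 1) - n := by
          have h1 := n.cast_nonneg (α := ℝ)
          have h2 := k.cast_nonneg (α := ℝ)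
          linarith
        positivity
      exact this.ne'
    have hCa : C a = ((n : ℝ[X]) + 1) * (2 * ((n + k + 1 : ℕ) : ℝ[X]) - (n : ℝ[X])) := by
      have h2 : C (2 : ℝ) = (2 : ℝ[X]) := map_ofNat C 2
      simp [ha, h2]
    refine ⟨-c / a, ?_⟩
    have h1 : C a * rodrigues (n + k + 1) n =
        C (-c) * (1 - X ^ 2) ^ (k + 1) * rodrigues (n + k + 1) (n + k + 1 + (k + 1)) := by
      rw [hCa, C_neg]
      have e3 : n + k + 1 + (k + 1) = n + k + 1 + k + 1 := by ring
      rw [e3]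
      rw [show n + 1 + 1 = n + 2 by ring] at hd
      push_cast at ho ⊢
      linear_combination ho - (1 - X ^ 2) * hd - 2 * (k : ℝ[X]) * X * hc -
        C c * rodrigues (n + k + 1) (n + k + 1 + k) * hp
    have h2 : C (-c / a) = C a⁻¹ * C (-c) := by rw [← C_mul]; congr 1; ring
    have h3 : C a⁻¹ * C a = (1 : ℝ[X]) := by rw [← C_mul, inv_mul_cancel₀ ha0, C_1]
    rw [h2]
    linear_combination C a⁻¹ * h1 - rodrigues (n + k + 1) n * h3

lemma rpow_half_eq (s : ℝ) (hs : 0 ≤ s) (k : ℕ) : s ^ ((k : ℝ) / 2) = Real.sqrt s ^ k := by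
  rw [Real.sqrt_eq_rpow, ← Real.rpow_natCast, ← Real.rpow_mul hs]
  congr 1
  ring

lemma exists_assocLegendre_eq (ℓ : ℕ) (m : ℤ) (hm : |m| ≤ (ℓ : ℤ)) :
    ∃ c : ℝ, ∀ t ∈ Icc (-1 : ℝ) 1, assocLegendre ℓ m t =
      c * (Real.sqrt (1 - t ^ 2) ^ m.natAbs * (rodrigues ℓ (ℓ + m.natAbs)).eval t) := by
  have hs : ∀ t ∈ Icc (-1 : ℝ) 1, 0 ≤ 1 - t ^ 2 := fun t ht => by nlinarith [ht.1, ht.2]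
  obtain ⟨k, rfl | rfl⟩ := m.eq_nat_or_neg
  · refine ⟨(-1 : ℝ) ^ (k : ℤ) / (2 ^ ℓ * (ℓ.factorial : ℝ)), fun t ht => ?_⟩
    have e : ((ℓ : ℤ) + (k : ℤ)).toNat = ℓ + k := by omega
    rw [assocLegendre, e, Int.natAbs_natCast, Int.cast_natCast, rpow_half_eq _ (hs t ht), rodrigues]
    ring
  · have hk : k ≤ ℓ := by simpa using hm
    obtain ⟨c, hc⟩ := exists_rodrigues_symm ℓ k hk
    refine ⟨(-1 : ℝ) ^ (-(k : ℤ)) / (2 ^ ℓ * (ℓ.factorial : ℝ)) * c, fun t ht => ?_⟩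
    have e : ((ℓ : ℤ) + -(k : ℤ)).toNat = ℓ - k := by omega
    -- At `t = ±1` with `k > 0` the negative power takes a default value, made irrelevant by the
    -- vanishing factor `(1 - t²)^k`.
    have h1 : (1 - t ^ 2) ^ (((-(k : ℤ) : ℤ) : ℝ) / 2) * (1 - t ^ 2) ^ k =
        Real.sqrt (1 - t ^ 2) ^ k := by
      rcases (hs t ht).eq_or_lt with h0 | h0
      · rw [← h0]
        rcases k with _ | k
        · simp
        · simp
      · have e2 : (((-(k : ℤ) : ℤ) : ℝ) / 2) = -((k : ℝ) / 2) := by push_cast; ring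
        have hne : Real.sqrt (1 - t ^ 2) ≠ 0 := (Real.sqrt_pos.mpr h0).ne'
        rw [e2, Real.rpow_neg h0.le, rpow_half_eq _ h0.le]
        conv_lhs => rw [← Real.sq_sqrt h0.le]
        rw [Real.sqrt_sq (Real.sqrt_nonneg _)]
        field_simp
        ring
    rw [assocLegendre, e, Int.natAbs_neg, Int.natAbs_natCast, ← h1]
    change _ * _ * (rodrigues ℓ (ℓ - k)).eval t = _
    rw [hc]
    simp
    ring

lemma angSq_mul (a b : MvPolynomial (Fin 3) ℂ) :
    angSq (a * b) = angSq a * b + 2 * ∑ i, ang i a * ang i b + a * angSq b := by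
  simp [angSq, Fin.sum_univ_three, Derivation.leibniz]
  ring

open MvPolynomial in
/-- The polynomial `(x₀ + ε x₁)^k Q(x₂)`. -/
def sectoral (ε : ℂ) (k : ℕ) (Q : Polynomial ℂ) : MvPolynomial (Fin 3) ℂ :=
  (X 0 + C ε * X 1) ^ k * Polynomial.aeval (X 2) Q

/-- The product rule for `L²`. Since `ε² = -1`, `u = X₀ + ε X₁` is isotropic, whence `Lu·Lu = -u²`
and `Lu·Lz = -uz`, while `Lz·Lz = X₀² + X₁²`. -/
lemma angSq_sectoral {ε : ℂ} (hε : ε ^ 2 = -1) (k : ℕ) (Q : Polynomial ℂ) :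
    angSq (sectoral ε k Q) = (MvPolynomial.X 0 ^ 2 + MvPolynomial.X 1 ^ 2) *
        sectoral ε k (Polynomial.derivative (Polynomial.derivative Q)) -
      2 * ((k : MvPolynomial (Fin 3) ℂ) + 1) * MvPolynomial.X 2 * sectoral ε k (Polynomial.derivative Q) -
      (k : MvPolynomial (Fin 3) ℂ) * ((k : MvPolynomial (Fin 3) ℂ) + 1) * sectoral ε k Q := by
  set u : MvPolynomial (Fin 3) ℂ := MvPolynomial.X 0 + MvPolynomial.C ε * MvPolynomial.X 1 with hu
  set z : MvPolynomial (Fin 3) ℂ := MvPolynomial.X 2 with hz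
  have hC : (MvPolynomial.C ε : MvPolynomial (Fin 3) ℂ) ^ 2 = -1 := by
    rw [← map_pow, hε, map_neg, map_one]
  have huu : ∑ i, ang i u * ang i u = -u ^ 2 := by
    simp [hu, Fin.sum_univ_three, ang_apply, Fin.reduceAdd, MvPolynomial.pderiv_X, Pi.single_apply,
      Derivation.leibniz]
    linear_combination (MvPolynomial.X 0 ^ 2 + MvPolynomial.X 1 ^ 2 + MvPolynomial.X 2 ^ 2) * hC
  have huz : ∑ i, ang i u * ang i z = -(u * z) := by
    simp [hu, hz, Fin.sum_univ_three, ang_apply, Fin.reduceAdd, MvPolynomial.pderiv_X,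
      Derivation.leibniz]
    ring
  have hzz : ∑ i, ang i z * ang i z = MvPolynomial.X 0 ^ 2 + MvPolynomial.X 1 ^ 2 := by
    simp [hz, Fin.sum_univ_three, ang_apply, Fin.reduceAdd, MvPolynomial.pderiv_X]
    ring
  have hu2 : angSq u = -(2 * u) := by
    simp [hu, angSq, Fin.sum_univ_three, ang_apply, Fin.reduceAdd, MvPolynomial.pderiv_X,
      Derivation.leibniz]
    ring
  have hz2 : angSq z = -(2 * z) := by
    simp [hz, angSq, Fin.sum_univ_three, ang_apply, Fin.reduceAdd, MvPolynomial.pderiv_X]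
    ring
  -- The extra factor `u` avoids the exponent `k - 1`; it is cancelled later.
  have hpow : ∀ (k : ℕ) (w : MvPolynomial (Fin 3) ℂ),
      u * ∑ i, ang i (u ^ k) * ang i w = k * u ^ k * ∑ i, ang i u * ang i w := by
    intro k w
    rw [Finset.mul_sum, Finset.mul_sum]
    refine Finset.sum_congr rfl fun i _ => ?_
    rw [Derivation.leibniz_pow]
    rcases k with _ | k
    · simp
    · simp
      ring
  have hu0 : u ≠ 0 := by
    intro h
    have := congrArg (MvPolynomial.pderiv 0) h
    simp [hu] at this
  have huk : ∀ k : ℕ, angSq (u ^ k) = -(k * (k + 1) * u ^ k) := by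
    intro k
    induction k with
    | zero => simp [angSq]
    | succ k ih =>
      have h := hpow k u
      rw [huu] at h
      rw [pow_succ, angSq_mul, ih, hu2]
      apply mul_left_cancel₀ hu0
      push_cast
      linear_combination 2 * h
  have hcross : ∑ i, ang i (u ^ k) * ang i z = -(k * u ^ k * z) := by
    have h := hpow k z
    rw [huz] at h
    apply mul_left_cancel₀ hu0
    linear_combination h
  have hQ : ∀ (P : Polynomial ℂ) (i : Fin 3), ang i (Polynomial.aeval z P) =
      Polynomial.aeval z (Polynomial.derivative P) * ang i z := by
    intro P i
    rw [Derivation.map_aeval, smul_eq_mul]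
  have hQ1 : ∑ i, ang i (u ^ k) * ang i (Polynomial.aeval z Q) =
      -(k * u ^ k * z) * Polynomial.aeval z (Polynomial.derivative Q) := by
    rw [← hcross, Finset.sum_mul]
    exact Finset.sum_congr rfl fun i _ => by rw [hQ]; ring
  have hQ2 : angSq (Polynomial.aeval z Q) =
      Polynomial.aeval z (Polynomial.derivative (Polynomial.derivative Q)) *
        (MvPolynomial.X 0 ^ 2 + MvPolynomial.X 1 ^ 2) -
      2 * z * Polynomial.aeval z (Polynomial.derivative Q) := by
    have h1 : angSq (Polynomial.aeval z Q) =
        Polynomial.aeval z (Polynomial.derivative (Polynomial.derivative Q)) *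
          (∑ i, ang i z * ang i z) +
        Polynomial.aeval z (Polynomial.derivative Q) * angSq z := by
      rw [angSq, angSq, Finset.mul_sum, Finset.mul_sum, ← Finset.sum_add_distrib]
      refine Finset.sum_congr rfl fun i _ => ?_
      rw [hQ, Derivation.leibniz, hQ]
      simp only [smul_eq_mul]
      ring
    rw [h1, hzz, hz2]
    ring
  simp only [sectoral, ← hu, ← hz]
  rw [angSq_mul, huk, hQ1, hQ2]
  ring

lemma pval_sectoral (ε : ℂ) (k : ℕ) (P : Polynomial ℝ) (y : E3) :
    pval (sectoral ε k (P.map Complex.ofRealHom)) y =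
      ((y 0 : ℂ) + ε * (y 1 : ℂ)) ^ k * ((P.eval (y 2) : ℝ) : ℂ) := by
  have h1 : pval (Polynomial.aeval (MvPolynomial.X 2) (P.map Complex.ofRealHom)) y =
      (P.map Complex.ofRealHom).eval ((y 2 : ℝ) : ℂ) := by
    rw [pval, ← MvPolynomial.coe_aeval_eq_eval]
    change MvPolynomial.aeval _ _ = _
    rw [← Polynomial.aeval_algHom_apply, MvPolynomial.aeval_X, Polynomial.coe_aeval_eq_eval]
  have h2 : (P.map Complex.ofRealHom).eval ((y 2 : ℝ) : ℂ) = ((P.eval (y 2) : ℝ) : ℂ) :=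
    Polynomial.eval_map_apply (f := Complex.ofRealHom) _
  rw [sectoral, pval_mul, h1, h2]
  simp

-- On the sphere `y₀² + y₁² = 1 - y₂²`, so the formula for `angSq` reduces to Rodrigues' equation of
-- order `ℓ + k`.
open Polynomial in
lemma isEigen_sectoral {ε : ℂ} (hε : ε ^ 2 = -1) (ℓ k : ℕ) :
    IsEigen ℓ (sectoral ε k ((rodrigues ℓ (ℓ + k)).map Complex.ofRealHom)) := by
  intro y
  have hr := sphere_sq_complex y
  set Q := rodrigues ℓ (ℓ + k) with hQ
  have ho := congrArg (fun P : ℝ[X] => ((P.eval ((y : E3) 2) : ℝ) : ℂ)) (rodrigues_ode ℓ (ℓ + k))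
  rw [angSq_sectoral hε]
  simp only [Polynomial.derivative_map, derivative_rodrigues, hQ] at ho ⊢
  have h2 : pval 2 y = 2 := pval_natCast 2 y
  simp only [pval_sub, pval_mul, pval_add, pval_pow, pval_X, pval_natCast, pval_one, h2, pval_sectoral]
  push_cast [eval_add, eval_mul, eval_sub, eval_pow, eval_X, eval_one, eval_natCast,
    eval_ofNat, eval_zero] at ho
  simp only [add_assoc, Nat.reduceAdd] at ho ⊢
  linear_combination (((y : E3) 0 : ℂ) + ε * ((y : E3) 1 : ℂ)) ^ k *
    (ho + (((rodrigues ℓ (ℓ + (k + 2))).eval ((y : E3) 2) : ℝ) : ℂ) * hr)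

lemma norm_equatorial (x : S2) :
    ‖(⟨(x : E3) 0, (x : E3) 1⟩ : ℂ)‖ = Real.sqrt (1 - (x : E3) 2 ^ 2) := by
  have h := sphere_sq x
  rw [Complex.norm_eq_sqrt_sq_add_sq]
  congr 1
  linarith

/-- This is `sin θ e^{iφ} = x₀ + i x₁`. It also holds at the poles, where the longitude is arbitrary
but both sides vanish. -/
lemma exp_longitude (x : S2) :
    (Real.sqrt (1 - (x : E3) 2 ^ 2) : ℂ) * Complex.exp (Complex.I * (longitude x : ℂ)) =
      ((x : E3) 0 : ℂ) + Complex.I * ((x : E3) 1 : ℂ) := by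
  have h := Complex.norm_mul_exp_arg_mul_I (⟨(x : E3) 0, (x : E3) 1⟩ : ℂ)
  rw [norm_equatorial] at h
  rw [longitude, mul_comm Complex.I, h, Complex.mk_eq_add_mul_I, mul_comm Complex.I]

lemma exp_neg_longitude (x : S2) :
    (Real.sqrt (1 - (x : E3) 2 ^ 2) : ℂ) * Complex.exp (-(Complex.I * (longitude x : ℂ))) =
      ((x : E3) 0 : ℂ) + -Complex.I * ((x : E3) 1 : ℂ) := by
  have h := congrArg (starRingEnd ℂ) (exp_longitude x)
  simpa [← Complex.exp_conj] using h

/-- Spherical harmonics are restrictions of polynomials which are eigenfunctions of the angular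
momentum operator. -/
theorem exists_sphHarm_eq_pval (ℓ : ℕ) (m : ℤ) (hm : |m| ≤ (ℓ : ℤ)) :
    ∃ p : MvPolynomial (Fin 3) ℂ, IsEigen ℓ p ∧ sphHarm ℓ m = fun y : S2 => pval p y := by
  obtain ⟨c, hc⟩ := exists_assocLegendre_eq ℓ m hm
  have hexp : ∃ ε : ℂ, ε ^ 2 = -1 ∧ ∀ x : S2,
      Complex.exp (Complex.I * (m : ℂ) * (longitude x : ℂ)) *
        (Real.sqrt (1 - (x : E3) 2 ^ 2) : ℂ) ^ m.natAbs =
      (((x : E3) 0 : ℂ) + ε * ((x : E3) 1 : ℂ)) ^ m.natAbs := by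
    obtain ⟨k, rfl | rfl⟩ := m.eq_nat_or_neg
    · refine ⟨Complex.I, Complex.I_sq, fun x => ?_⟩
      rw [Int.natAbs_natCast, ← exp_longitude, mul_pow, ← Complex.exp_nat_mul, mul_comm]
      congr 2
      push_cast
      ring
    · refine ⟨-Complex.I, by rw [neg_sq, Complex.I_sq], fun x => ?_⟩
      rw [Int.natAbs_neg, Int.natAbs_natCast, ← exp_neg_longitude, mul_pow, ← Complex.exp_nat_mul,
        mul_comm]
      congr 2
      push_cast
      ring
  obtain ⟨ε, hε, hexp⟩ := hexp
  refine ⟨_, (isEigen_sectoral hε ℓ m.natAbs).C_mul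
    (((Real.sqrt (2 * Real.pi) : ℝ) : ℂ)⁻¹ * (Complex.I ^ (m + |m|) *
      ((Real.sqrt (((ℓ : ℝ) + 1 / 2) * (((ℓ : ℤ) - m).toNat.factorial : ℝ) /
      (((ℓ : ℤ) + m).toNat.factorial : ℝ)) : ℝ) : ℂ)) * (c : ℂ)), ?_⟩
  ext x
  have h2 : (x : E3) 2 ∈ Icc (-1 : ℝ) 1 := by
    have := sphere_sq x
    exact abs_le.mp (by rw [← sq_le_one_iff_abs_le_one]; nlinarith)
  rw [sphHarm, normLegendre, hc _ h2, pval_mul, pval_C, pval_sectoral, ← hexp]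
  push_cast
  ring

/-! ### Vector identities on the sphere -/

lemma cross_comp (a b : Fin 3 → ℂ) (i : Fin 3) :
    (a ⨯₃ b) i = a (i + 1) * b (i + 2) - a (i + 2) * b (i + 1) := by
  fin_cases i <;> simp [cross_apply, Fin.reduceAdd]

lemma nu_cross_surfGrad (p : MvPolynomial (Fin 3) ℂ) (y : S2) :
    nu y ⨯₃ surfGrad (fun y => pval p y) y = fun i => pval (ang i p) y := by
  ext i
  rw [cross_comp, surfGrad_pval, surfGrad_pval]
  simp only [nu, tang, ang_apply, pval_sub, pval_mul, pval_X]
  ring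

lemma pval_tang_eq (p : MvPolynomial (Fin 3) ℂ) (x : S2) (i : Fin 3) :
    pval (tang i p) x = nu x (i + 2) * pval (ang (i + 1) p) x -
      nu x (i + 1) * pval (ang (i + 2) p) x := by
  have hr := sphere_sq_complex x
  fin_cases i <;>
    simp [tang, ang_apply, Fin.reduceAdd, Fin.sum_univ_three, nu]
  · linear_combination -pval (MvPolynomial.pderiv 0 p) x * hr
  · linear_combination -pval (MvPolynomial.pderiv 1 p) x * hr
  · linear_combination -pval (MvPolynomial.pderiv 2 p) x * hr

lemma nu_sub_nu (x y : S2) (i : Fin 3) :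
    nu y i - nu x i = nu x (i + 2) * crossS (i + 1) x y - nu x (i + 1) * crossS (i + 2) x y +
      ((dotS x y : ℂ) - 1) * nu x i := by
  have hr := sphere_sq_complex x
  fin_cases i <;> simp [crossS, dotS_eq, nu, Fin.reduceAdd]
  · linear_combination -((y : E3) 0 : ℂ) * hr
  · linear_combination -((y : E3) 1 : ℂ) * hr
  · linear_combination -((y : E3) 2 : ℂ) * hr

/-- The surface curl `∇_S × L p`, whose normal part is the Laplacian. It evaluates the right side of
the third formula. -/
lemma tang_cross_ang (p : MvPolynomial (Fin 3) ℂ) (x : S2) (i : Fin 3) :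
    pval (tang (i + 1) (ang (i + 2) p)) x - pval (tang (i + 2) (ang (i + 1) p)) x =
      pval (angSq p) x * nu x i - pval (tang i p) x := by
  have hr := sphere_sq_complex x
  have h01 := pderiv_pderiv_comm 0 1 p
  have h02 := pderiv_pderiv_comm 0 2 p
  have h12 := pderiv_pderiv_comm 1 2 p
  fin_cases i <;>
    simp [Fin.sum_univ_three, tang, angSq, ang_apply, nu, Fin.reduceAdd, MvPolynomial.pderiv_X,
      h01, h02, h12] <;>
    generalize (((x : E3) 0 : ℝ) : ℂ) = a at * <;>
    generalize (((x : E3) 1 : ℝ) : ℂ) = b at * <;>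
    generalize (((x : E3) 2 : ℝ) : ℂ) = c at * <;>
    generalize pval (MvPolynomial.pderiv 0 p) x = p0 <;>
    generalize pval (MvPolynomial.pderiv 1 p) x = p1 <;>
    generalize pval (MvPolynomial.pderiv 2 p) x = p2 <;>
    generalize pval (MvPolynomial.pderiv 0 (MvPolynomial.pderiv 0 p)) x = p00 <;>
    generalize pval (MvPolynomial.pderiv 1 (MvPolynomial.pderiv 1 p)) x = p11 <;>
    generalize pval (MvPolynomial.pderiv 2 (MvPolynomial.pderiv 2 p)) x = p22 <;>
    generalize pval (MvPolynomial.pderiv 1 (MvPolynomial.pderiv 0 p)) x = p01 <;>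
    generalize pval (MvPolynomial.pderiv 2 (MvPolynomial.pderiv 0 p)) x = p02 <;>
    generalize pval (MvPolynomial.pderiv 2 (MvPolynomial.pderiv 1 p)) x = p12
  · linear_combination (-a * (p00 + p11 + p22) + p0 + (a * p00 + b * p01 + c * p02)) * hr
  · linear_combination (-b * (p00 + p11 + p22) + p1 + (a * p01 + b * p11 + c * p12)) * hr
  · linear_combination (-c * (p00 + p11 + p22) + p2 + (a * p02 + b * p12 + c * p22)) * hr

/-- The component of the infinitesimal rotations in the direction `x`. -/
def angDir (x : S2) (p : MvPolynomial (Fin 3) ℂ) : MvPolynomial (Fin 3) ℂ :=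
  MvPolynomial.C (nu x 0) * ang 0 p + MvPolynomial.C (nu x 1) * ang 1 p +
    MvPolynomial.C (nu x 2) * ang 2 p

lemma IsEigen.angDir {ℓ : ℕ} {p : MvPolynomial (Fin 3) ℂ} (hp : IsEigen ℓ p) (x : S2) :
    IsEigen ℓ (angDir x p) :=
  (((hp.ang 0).C_mul _).add ((hp.ang 1).C_mul _)).add ((hp.ang 2).C_mul _)

lemma pval_angDir (p : MvPolynomial (Fin 3) ℂ) (x y : S2) : pval (angDir x p) y =
    crossS 0 x y * pval (MvPolynomial.pderiv 0 p) y +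
      crossS 1 x y * pval (MvPolynomial.pderiv 1 p) y +
      crossS 2 x y * pval (MvPolynomial.pderiv 2 p) y := by
  simp [angDir, ang_apply, crossS, nu, Fin.reduceAdd]
  ring

lemma pval_angDir_self (p : MvPolynomial (Fin 3) ℂ) (x : S2) : pval (angDir x p) x = 0 := by
  rw [pval_angDir]
  simp [crossS]
  ring

/-- The field `y ↦ x × y` vanishes at `x`, so only its linear part enters the gradient of `(x ×
y)·∇p` there. -/
lemma pval_tang_angDir (p : MvPolynomial (Fin 3) ℂ) (x : S2) (i : Fin 3) :
    pval (tang i (angDir x p)) x = -pval (ang i p) x := by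
  have h01 := pderiv_pderiv_comm 0 1 p
  have h02 := pderiv_pderiv_comm 0 2 p
  have h12 := pderiv_pderiv_comm 1 2 p
  fin_cases i <;>
    simp [Fin.sum_univ_three, tang, angDir, ang_apply, nu, Fin.reduceAdd, MvPolynomial.pderiv_X,
      Derivation.leibniz, h01, h02, h12] <;> ring

/-- From `y × ∇_S p = L p` and `∇_S p = -y × L p`, the triple product expansion gives `(y - x) × ∇_S
p = y (x·L p) + (1 - x·y) L p`. Splitting `y = (y - x) + x` reduces every term to a scalar integral
already known. -/
lemma sub_cross_surfGrad (p : MvPolynomial (Fin 3) ℂ) (x y : S2) (i : Fin 3) :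
    ((nu y - nu x) ⨯₃ surfGrad (fun y => pval p y) y) i =
      (nu y i - nu x i) * pval (angDir x p) y + nu x i * pval (angDir x p) y +
        (1 - (dotS x y : ℂ)) * pval (ang i p) y := by
  have hr := sphere_sq_complex y
  rw [cross_comp, surfGrad_pval, surfGrad_pval]
  simp only [Pi.sub_apply, nu]
  fin_cases i <;>
    simp [tang, angDir, ang_apply, dotS_eq, Fin.reduceAdd, Fin.sum_univ_three, nu] <;>
    generalize (((x : E3) 0 : ℝ) : ℂ) = a <;>
    generalize (((x : E3) 1 : ℝ) : ℂ) = b <;>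
    generalize (((x : E3) 2 : ℝ) : ℂ) = c <;>
    generalize pval (MvPolynomial.pderiv 0 p) y = p0 <;>
    generalize pval (MvPolynomial.pderiv 1 p) y = p1 <;>
    generalize pval (MvPolynomial.pderiv 2 p) y = p2
  · linear_combination (b * p2 - c * p1) * hr
  · linear_combination (c * p0 - a * p2) * hr
  · linear_combination (a * p1 - b * p0) * hr

/-! ### Assembly of the vector formulas -/

lemma integrableOn_legendreP_mul (ℓ : ℕ) {g : ℝ → ℝ} (hg : IntegrableOn g (Ioo (-1 : ℝ) 1)) :
    IntegrableOn (fun t => legendreP ℓ t * g t) (Ioo (-1 : ℝ) 1) := by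
  obtain ⟨C, hC⟩ := (isCompact_Icc (a := (-1 : ℝ)) (b := 1)).exists_bound_of_continuousOn
    (continuous_legendreP ℓ).continuousOn
  exact Integrable.bdd_mul hg (continuous_legendreP ℓ).aestronglyMeasurable
    ((ae_restrict_mem measurableSet_Ioo).mono fun t ht => hC t (Ioo_subset_Icc_self ht))

lemma lam_sub (ℓ : ℕ) {g h : ℝ → ℝ} (hg : IntegrableOn g (Ioo (-1 : ℝ) 1))
    (hh : IntegrableOn h (Ioo (-1 : ℝ) 1)) :
    lam ℓ (fun t => g t - h t) = lam ℓ g - lam ℓ h := by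
  simp only [lam, mul_sub]
  rw [integral_sub (integrableOn_legendreP_mul ℓ hg) (integrableOn_legendreP_mul ℓ hh), mul_sub]

lemma lam_neg (ℓ : ℕ) (g : ℝ → ℝ) : lam ℓ (fun t => -g t) = -lam ℓ g := by
  simp only [lam, mul_neg, integral_neg]

lemma hasSurfIntegral_of_hasInt {F : S2 → Fin 3 → ℂ} {V : Fin 3 → ℂ}
    (h : ∀ i, HasInt (fun y => F y i) (V i)) : HasSurfIntegral F V := by
  refine ⟨integrable_pi_iff.mpr fun i => (h i).1, ?_⟩
  ext i
  rw [eval_integral fun j => (h j).1, (h i).2]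

lemma HasInt.congr {F G : S2 → ℂ} {v w : ℂ} (h : HasInt F v) (hFG : ∀ y, G y = F y)
    (hvw : w = v) : HasInt G w := by
  rw [funext hFG, hvw]
  exact h

/-- The localization formula for scalar functions, componentwise. -/
lemma IsEigen.hasInt_sub {ℓ : ℕ} {p : MvPolynomial (Fin 3) ℂ} (hp : IsEigen ℓ p)
    {f f' : ℝ → ℝ} (hf : IntegrableOn f (Ioo (-1 : ℝ) 1)) (hderiv : IsWeakDeriv f f')
    (hf' : IntegrableOn (fun t => Real.sqrt (1 - t ^ 2) * f' t) (Ioo (-1 : ℝ) 1))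
    (hf'' : IntegrableOn (fun t => (t - 1) * f' t) (Ioo (-1 : ℝ) 1)) (i : Fin 3) (x : S2) :
    HasInt (fun y => (f' (dotS x y) : ℂ) * ((nu y i - nu x i) * pval p y))
      (lam ℓ f * pval (tang i p) x + lam ℓ (fun t => (t - 1) * f' t) * (nu x i * pval p x)) := by
  have h1 := (hp.hasInt_cross hf hderiv hf' (i + 1) x).const_mul (nu x (i + 2))
  have h2 := (hp.hasInt_cross hf hderiv hf' (i + 2) x).const_mul (-nu x (i + 1))
  have h3 := (hp.funkHecke x hf'').const_mul (nu x i)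
  refine ((h1.add h2).add h3).congr (fun y => ?_) ?_
  · rw [nu_sub_nu]
    push_cast
    ring
  · rw [pval_tang_eq]
    ring

/-- The localization formulas for a polynomial eigenfunction on the sphere. -/
theorem IsEigen.localization {ℓ : ℕ} {p : MvPolynomial (Fin 3) ℂ} (hp : IsEigen ℓ p)
    {f f' : ℝ → ℝ} (hf : IntegrableOn f (Ioo (-1 : ℝ) 1)) (hderiv : IsWeakDeriv f f')
    (hf' : IntegrableOn (fun t => Real.sqrt (1 - t ^ 2) * f' t) (Ioo (-1 : ℝ) 1)) (x : S2) :
    (IntegrableOn (fun t => (1 - t) * f' t) (Ioo (-1 : ℝ) 1) →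
      HasSurfIntegral
        (fun y => ((f' (dotS x y) : ℝ) : ℂ) •
          (pval p y • (nu y - nu x)))
        (((lam ℓ (fun t => (t - 1) * f' t) : ℝ) : ℂ) •
            (pval p x • nu x) +
          ((lam ℓ f : ℝ) : ℂ) •
            surfGrad (fun y => pval p y) x) ∧
      HasSurfIntegral
        (fun y => ((f' (dotS x y) : ℝ) : ℂ) •
          ((nu y - nu x) ⨯₃
            surfGrad (fun y => pval p y) y))
        (((lam ℓ (fun t => (1 - t) * f' t - f t) : ℝ) : ℂ) •
          (nu x ⨯₃ surfGrad (fun y => pval p y) x)) ∧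
      HasSurfIntegral
        (fun y => ((f' (dotS x y) : ℝ) : ℂ) •
          ((nu y - nu x) ⨯₃
            (nu y ⨯₃ surfGrad (fun y => pval p y) y)))
        (((lam ℓ f : ℝ) : ℂ) •
            (surfLaplacian (fun y => pval p y) x • nu x) +
          ((lam ℓ (fun t => (1 - t) * f' t - f t) : ℝ) : ℂ) •
            surfGrad (fun y => pval p y) x)) ∧
    HasSurfIntegral
      (fun y => ((f' (dotS x y) : ℝ) : ℂ) •
        ((nu y - nu x) ⨯₃
          (pval p y • nu y)))
      (-(((lam ℓ f : ℝ) : ℂ) •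
        (nu x ⨯₃ surfGrad (fun y => pval p y) x))) := by
  have hm' : AEStronglyMeasurable f' (volume.restrict (Ioo (-1 : ℝ) 1)) :=
    hderiv.2.1.aestronglyMeasurable
  refine ⟨fun h1 => ?_, ?_⟩
  · have e1 : (fun t => (t - 1) * f' t) = fun t => -((1 - t) * f' t) := by ext t; ring
    have h1' : IntegrableOn (fun t => (t - 1) * f' t) (Ioo (-1 : ℝ) 1) := by
      rw [e1]; exact h1.neg
    have hlam : (lam ℓ (fun t => (1 - t) * f' t - f t) : ℂ) =
        lam ℓ (fun t => (1 - t) * f' t) - lam ℓ f := by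
      rw [lam_sub ℓ h1 hf, Complex.ofReal_sub]
    have hlam' : (lam ℓ (fun t => (t - 1) * f' t) : ℂ) = -lam ℓ (fun t => (1 - t) * f' t) := by
      rw [e1, lam_neg, Complex.ofReal_neg]
    refine ⟨hasSurfIntegral_of_hasInt fun i => ?_, hasSurfIntegral_of_hasInt fun i => ?_,
      hasSurfIntegral_of_hasInt fun i => ?_⟩
    · refine (hp.hasInt_sub hf hderiv hf' h1' i x).congr (fun y => ?_) ?_
      · simp only [Pi.smul_apply, Pi.sub_apply, smul_eq_mul]
        ring
      · simp only [Pi.add_apply, Pi.smul_apply, smul_eq_mul, surfGrad_pval]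
        ring
    · have hi : Integrable (fun y => (f' (dotS x y) : ℂ) * pval (SphereCalc.angDir x p) y) surf := by
        refine (((integrable_cross hm' hf' 0 x
            (continuous_pval_sphere (MvPolynomial.pderiv 0 p))).add
          (integrable_cross hm' hf' 1 x
            (continuous_pval_sphere (MvPolynomial.pderiv 1 p)))).add
          (integrable_cross hm' hf' 2 x
            (continuous_pval_sphere (MvPolynomial.pderiv 2 p)))).congr
          (Filter.Eventually.of_forall fun y => ?_)
        · simp only [Pi.add_apply]
          rw [pval_angDir]
          ring
      have k1 := (hp.angDir x).hasInt_sub hf hderiv hf' h1' i x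
      have k2 := ((hp.angDir x).funkHecke_of_zero (pval_angDir_self p x) hm' hi).const_mul (nu x i)
      have k3 := (hp.ang i).funkHecke x h1
      refine ((k1.add k2).add k3).congr (fun y => ?_) ?_
      · rw [Pi.smul_apply, sub_cross_surfGrad]
        push_cast
        simp only [smul_eq_mul]
        ring
      · rw [Pi.smul_apply, nu_cross_surfGrad, pval_tang_angDir, pval_angDir_self, hlam]
        simp only [smul_eq_mul]
        ring
    -- Each component of `(y - x) × L p` is a difference of two instances of the scalar formula,
    -- applied to the eigenfunctions `L_{i+2} p` and `L_{i+1} p`.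
    · have k1 := (hp.ang (i + 2)).hasInt_sub hf hderiv hf' h1' (i + 1) x
      have k2 := ((hp.ang (i + 1)).hasInt_sub hf hderiv hf' h1' (i + 2) x).const_mul (-1)
      refine (k1.add k2).congr (fun y => ?_) ?_
      · rw [Pi.smul_apply, nu_cross_surfGrad, cross_comp]
        simp only [Pi.sub_apply, smul_eq_mul]
        ring
      · have h := tang_cross_ang p x i
        have h' := pval_tang_eq p x i
        simp only [Pi.add_apply, Pi.smul_apply, smul_eq_mul, surfGrad_pval, surfLaplacian_pval]
        rw [hlam, hlam']
        linear_combination -(lam ℓ f : ℂ) * h + (lam ℓ (fun t => (1 - t) * f' t) : ℂ) * h'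
  · refine hasSurfIntegral_of_hasInt fun i => ?_
    -- Since `(y - x) × y = -x × y`, only the tangential integral occurs, and integrability of `(1 -
    -- t) f'` plays no role.
    refine ((hp.hasInt_cross hf hderiv hf' i x).const_mul (-1)).congr (fun y => ?_) ?_
    · rw [Pi.smul_apply, cross_comp]
      simp only [Pi.sub_apply, Pi.smul_apply, smul_eq_mul, nu, crossS]
      push_cast
      ring
    · rw [Pi.neg_apply, Pi.smul_apply, nu_cross_surfGrad]
      simp only [smul_eq_mul]
      ring

end SphereCalc

end

theorem mainTheorem4 (f f' : ℝ → ℝ)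
    (hf : IntegrableOn f (Ioo (-1 : ℝ) 1))
    (hderiv : SphereCalc.IsWeakDeriv f f')
    (hf' : IntegrableOn (fun t => Real.sqrt (1 - t ^ 2) * f' t) (Ioo (-1 : ℝ) 1))
    (ℓ : ℕ) (m : ℤ) (hm : |m| ≤ (ℓ : ℤ)) (x : SphereCalc.S2) :
    (IntegrableOn (fun t => (1 - t) * f' t) (Ioo (-1 : ℝ) 1) →
      SphereCalc.HasSurfIntegral
        (fun y => ((f' (SphereCalc.dotS x y) : ℝ) : ℂ) •
          (SphereCalc.sphHarm ℓ m y • (SphereCalc.nu y - SphereCalc.nu x)))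
        (((SphereCalc.lam ℓ (fun t => (t - 1) * f' t) : ℝ) : ℂ) •
            (SphereCalc.sphHarm ℓ m x • SphereCalc.nu x) +
          ((SphereCalc.lam ℓ f : ℝ) : ℂ) •
            SphereCalc.surfGrad (SphereCalc.sphHarm ℓ m) x) ∧
      SphereCalc.HasSurfIntegral
        (fun y => ((f' (SphereCalc.dotS x y) : ℝ) : ℂ) •
          ((SphereCalc.nu y - SphereCalc.nu x) ⨯₃
            SphereCalc.surfGrad (SphereCalc.sphHarm ℓ m) y))
        (((SphereCalc.lam ℓ (fun t => (1 - t) * f' t - f t) : ℝ) : ℂ) •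
          (SphereCalc.nu x ⨯₃ SphereCalc.surfGrad (SphereCalc.sphHarm ℓ m) x)) ∧
      SphereCalc.HasSurfIntegral
        (fun y => ((f' (SphereCalc.dotS x y) : ℝ) : ℂ) •
          ((SphereCalc.nu y - SphereCalc.nu x) ⨯₃
            (SphereCalc.nu y ⨯₃ SphereCalc.surfGrad (SphereCalc.sphHarm ℓ m) y)))
        (((SphereCalc.lam ℓ f : ℝ) : ℂ) •
            (SphereCalc.surfLaplacian (SphereCalc.sphHarm ℓ m) x • SphereCalc.nu x) +
          ((SphereCalc.lam ℓ (fun t => (1 - t) * f' t - f t) : ℝ) : ℂ) •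
            SphereCalc.surfGrad (SphereCalc.sphHarm ℓ m) x)) ∧
    SphereCalc.HasSurfIntegral
      (fun y => ((f' (SphereCalc.dotS x y) : ℝ) : ℂ) •
        ((SphereCalc.nu y - SphereCalc.nu x) ⨯₃
          (SphereCalc.sphHarm ℓ m y • SphereCalc.nu y)))
      (-(((SphereCalc.lam ℓ f : ℝ) : ℂ) •
        (SphereCalc.nu x ⨯₃ SphereCalc.surfGrad (SphereCalc.sphHarm ℓ m) x))) := by
  obtain ⟨p, hp, hY⟩ := SphereCalc.exists_sphHarm_eq_pval ℓ m hm
  rw [hY]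
  exact hp.localization hf hderiv hf' x
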